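/- **Conventions.** Let $G$ be a group with a finite generating set $S$. For finitely supported $f\colon G\to\mathbb R$ let $\|f\|_1=\sum_{g}|f(g)|$ and $\|\nabla^l_S f\|_1=\sum_{g\in G,\,s\in S}|f(sg)-f(g)|$. The isoperimetric profile of $G$ is $$j_{1,G}(x)=\sup_{|\operatorname{supp} f|\le x}\frac{\|f\|_1}{\|\nabla^l_S f\|_1}\in[0,\infty]$$ (the quotient is $\infty$ if $f\neq 0$ has zero gradient, and $f=0$ contributes $0$), and the Følner function of $G$ is $$\text{Føl}_G(k)=\inf\{|A| : \emptyset\ne A\subset G\text{ finite},\ |SA\,\triangle\, A|/|A|\le 1/k\}\in[1,\infty],\qquad k\in[0,\infty].$$ For functions $f,g$ with values in $[0,\infty]$ write $f\preccurlyeq g$ (or $g\succcurlyeq f$) if there is $C>0$ with $f(x)=O(g(Cx))$ as $x\to\infty$. A fundamental domain of a measure-preserving action of a countable group on a measure space is a measurable set that meets almost every orbit in exactly one point. Let $\Gamma,\Lambda$ be countable groups. A *measure sub-quotient coupling* from $\Gamma$ to $\Lambda$ is a triple $(\Omega,X_\Lambda,\mu)$, where $(\Omega,\mu)$ is a standard Borel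 space with a nonzero $\sigma$-finite measure and with commuting measure-preserving actions of $\Gamma$ and $\Lambda$ (both written $*$), such that each action has a fundamental domain, the $\Gamma$-action is (essentially) free, and $X_\Lambda$ is a fundamental domain of finite measure for the $\Lambda$-action. It is a *measure quotient coupling* if moreover the $\Gamma$-action has a fundamental domain of finite measure. For $x\in X_\Lambda$ and $\gamma\in\Gamma$ let $\gamma\cdot x$ be the point of $X_\Lambda$ in the $\Lambda$-orbit of $\gamma*x$ (defined for almost every $x$). The coupling is *at most $m$-to-one* if for almost every $x\in X_\Lambda$ the map $\gamma\mapsto\gamma^{-1}*(\gamma\cdot x)$ has fibres of size at most $m$. If $\Lambda$ is generated by a finite set $S_\Lambda$, let $d_{S_\Lambda}(x,y)$ be the least length of a word in $S_\Lambda\cup S_\Lambda^{-1}$ that takes $x$ to $y$. The coupling is *$\varphi$-integrable* if for every $\gamma\in\Gamma$ the fundamental domains $X_\Lambda$ and $\gamma*X_\Lambda$ are $\varphi$-equivalent: there is $c>0$ with $$\int_{X_\Lambda}\varphi\bigl(d_{S_\Lambda}(x,x')/c\bigr)\,d\mu(x)<\infty,$$ where $x'$ is the point of $\gamma*X_\Lambda$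 in the $\Lambda$-orbit of $x$. The group $\Gamma$ is a $\varphi$-integrable measure quotient (resp. an at most $m$-to-one $\varphi$-integrable measure sub-quotient) of $\Lambda$ if there is a measure quotient (resp. sub-quotient) coupling from $\Gamma$ to $\Lambda$ with these properties. **Theorem.** Let $\varphi\colon(0,\infty)\to(0,\infty)$ be such that $\varphi$ and $t\mapsto t/\varphi(t)$ are non-decreasing, extended by $\varphi(0)=0$ and $\varphi(\infty)=\sup\varphi$, and let $\varphi^{-1}(k)=\inf\{t>0:\varphi(t)\ge k\}$, with $\inf\emptyset=\infty$. Let $\Gamma$ and $\Lambda$ be finitely generated groups, with finite generating sets $S_\Gamma$ and $S_\Lambda$. Assume that 1. $\Gamma$ is a $\varphi$-integrable measure quotient of $\Lambda$, or 2. for some $m\in\mathbb N$, $\Gamma$ is an at most $m$-to-one $\varphi$-integrable measure sub-quotient of $\Lambda$. Then $$j_{1,\Gamma}\succcurlyeq\varphi\circ j_{1,\Lambda}.$$ In terms of Følner functions, if $S_\Gamma\neq\emptyset$, then also $$\text{Føl}_\Gamma\preccurlyeq\text{Føl}_\Lambda\circ\varphi^{-1}.$$ -/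

import Mathlib

open MeasureTheory Filter
open scoped ENNReal NNReal Pointwise symmDiff

universe u v w

noncomputable section

namespace MeasureCoupling

/-! ### Isoperimetric profile and Følner function -/

section Isoperimetry

variable {G : Type u} [Group G]

/-- The `ℓ¹`-norm of a finitely supported function. -/
def l1norm (f : G →₀ ℝ) : ℝ≥0∞ := ∑' g : G, ‖f g‖ₑ

/-- The `ℓ¹`-norm of the left gradient, `∑_{g ∈ G, s ∈ S} |f (s g) - f g|`. -/
def l1grad (S : Finset G) (f : G →₀ ℝ) : ℝ≥0∞ :=
  ∑ s ∈ S, ∑' g : G, ‖f (s * g) - f g‖ₑ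

/-- The `ℓ¹`-isoperimetric profile `j₁(x) = sup { ‖f‖₁ / ‖∇ˡ f‖₁ : |supp f| ≤ x }`, with values in
`[0, ∞]`. The quotient is `∞` if the gradient of `f ≠ 0` vanishes (which happens only in finite
groups), and `f = 0` contributes `0`. -/
def isoProfile (S : Finset G) (x : ℝ) : ℝ≥0∞ :=
  ⨆ (f : G →₀ ℝ) (_ : (f.support.card : ℝ) ≤ x), l1norm f / l1grad S f

open Classical in
/-- The boundary `∂A = SA ∆ A`. -/
def boundary (S A : Finset G) : Finset G := (S * A) ∆ A

/-- The Følner function `Føl(k) = inf { |A| : |∂A| / |A| ≤ 1 / k }`, the infimum being over finite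
nonempty sets `A`, with `inf ∅ = ∞`. -/
def folner (S : Finset G) (k : ℝ≥0∞) : ℝ≥0∞ :=
  ⨅ (A : Finset G) (_ : A.Nonempty)
    (_ : ((boundary S A).card : ℝ≥0∞) / (A.card : ℝ≥0∞) ≤ k⁻¹), (A.card : ℝ≥0∞)

end Isoperimetry

/-- `f ≼ g`: there is `C > 0` with `f(x) = O(g(C x))` as `x → ∞`. -/
def AsympLE (f g : ℝ → ℝ≥0∞) : Prop :=
  ∃ C : ℝ, 0 < C ∧ ∃ M : ℝ≥0, ∀ᶠ x in atTop, f x ≤ (M : ℝ≥0∞) * g (C * x)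

/-- A function `φ : (0, ∞) → (0, ∞)`, extended to `[0, ∞]` by `φ(0) = 0` and `φ(∞) = sup φ`.
Only the values of `φ : ℝ → ℝ` at positive reals are used. -/
def extend (φ : ℝ → ℝ) (t : ℝ≥0∞) : ℝ≥0∞ :=
  if t = 0 then 0
  else if t = ∞ then ⨆ (s : ℝ) (_ : 0 < s), ENNReal.ofReal (φ s)
  else ENNReal.ofReal (φ t.toReal)

/-- The (generalized) inverse `φ⁻¹(k) = inf { t > 0 : φ(t) ≥ k }`, with `inf ∅ = ∞`. -/
def genInv (φ : ℝ → ℝ) (k : ℝ) : ℝ≥0∞ :=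
  ⨅ (t : ℝ) (_ : 0 < t) (_ : k ≤ φ t), ENNReal.ofReal t

/-! ### Actions, fundamental domains, Schreier metrics -/

section Actions

variable (G : Type u) [Group G] {Ω : Type w} [MulAction G Ω]

/-- The action of `G` is by Borel maps that preserve `μ`. -/
def IsMeasurePreservingAction [MeasurableSpace Ω] (μ : Measure Ω) : Prop :=
  ∀ g : G, MeasurePreserving (fun ω : Ω => g • ω) μ μ

/-- The action of `G` is (essentially) free. -/
def IsFreeAction [MeasurableSpace Ω] (μ : Measure Ω) : Prop :=
  ∀ g : G, g ≠ 1 → ∀ᵐ ω ∂μ, g • ω ≠ ω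

/-- A Borel set that meets almost every orbit in exactly one point. The action need not be free,
in contrast to `MeasureTheory.IsFundamentalDomain`. -/
def IsFundDomain [MeasurableSpace Ω] (μ : Measure Ω) (X : Set Ω) : Prop :=
  MeasurableSet X ∧ ∃ Ω₀ : Set Ω, MeasurableSet Ω₀ ∧ μ Ω₀ᶜ = 0 ∧
    (∀ (g : G), ∀ ω ∈ Ω₀, g • ω ∈ Ω₀) ∧
    ∀ ω ∈ Ω₀, ∃! y, y ∈ MulAction.orbit G ω ∧ y ∈ X

open Classical in
/-- The map that takes `ω` to the point of its orbit that lies in the fundamental domain `X`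
(defined almost everywhere; the value elsewhere is irrelevant). -/
def orbitProj (X : Set Ω) (ω : Ω) : Ω :=
  if h : ∃ y, y ∈ MulAction.orbit G ω ∧ y ∈ X then h.choose else ω

variable {G}

/-- The Schreier graph metric: the least length of a word in `S ∪ S⁻¹` that takes `x` to `y`
(`∞` if `x` and `y` are in different orbits). -/
def schreierDist (S : Finset G) (x y : Ω) : ℝ≥0∞ :=
  ⨅ (l : List G) (_ : ∀ s ∈ l, s ∈ S ∨ s⁻¹ ∈ S) (_ : l.prod • x = y), (l.length : ℝ≥0∞)

/-- `φ`-equivalence of two fundamental domains `X₁`, `X₂`. The quotient space of the action is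
identified with `X₁`, and then the section with values in `X₂` is `orbitProj G X₂`. -/
def PhiEquivalent [MeasurableSpace Ω] (S : Finset G) (φ : ℝ → ℝ) (μ : Measure Ω)
    (X₁ X₂ : Set Ω) : Prop :=
  ∃ c : ℝ≥0, 0 < c ∧
    ∫⁻ x in X₁, extend φ (schreierDist S x (orbitProj G X₂ x) / (c : ℝ≥0∞)) ∂μ < ∞

end Actions

/-! ### Couplings -/

section Couplings

variable (Γ : Type u) (Λ : Type v) [Group Γ] [Group Λ] {Ω : Type w} [MeasurableSpace Ω]
  [MulAction Γ Ω] [MulAction Λ Ω]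

/-- `(Ω, X, μ)` is a measure sub-quotient coupling from `Γ` to `Λ`. -/
structure IsSubQuotientCoupling (μ : Measure Ω) (X : Set Ω) : Prop where
  standardBorel : StandardBorelSpace Ω
  sigmaFinite : SigmaFinite μ
  ne_zero : μ ≠ 0
  commute : ∀ (a : Γ) (b : Λ) (ω : Ω), a • b • ω = b • a • ω
  preserving_left : IsMeasurePreservingAction Γ μ
  preserving_right : IsMeasurePreservingAction Λ μ
  smooth_left : ∃ Y : Set Ω, IsFundDomain Γ μ Y
  free_left : IsFreeAction Γ μ
  fundDomain : IsFundDomain Λ μ X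
  finite : μ X < ∞

/-- `(Ω, X, μ)` is a measure quotient coupling from `Γ` to `Λ`: moreover, the `Γ`-action admits a
fundamental domain of finite measure. -/
structure IsQuotientCoupling (μ : Measure Ω) (X : Set Ω) : Prop
    extends IsSubQuotientCoupling Γ Λ μ X where
  finite_left : ∃ Y : Set Ω, IsFundDomain Γ μ Y ∧ μ Y < ∞

/-- The coupling is `φ`-integrable: `X` and `γ * X` are `φ`-equivalent for every `γ`. -/
def IsPhiIntegrable {Λ : Type v} [Group Λ] [MulAction Λ Ω] (S : Finset Λ) (φ : ℝ → ℝ)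
    (μ : Measure Ω) (X : Set Ω) : Prop :=
  ∀ a : Γ, PhiEquivalent S φ μ X ((fun ω : Ω => a • ω) '' X)

/-- The coupling is at most `m`-to-one: for almost every `x ∈ X`, the map
`γ ↦ γ⁻¹ * (γ · x)` has fibres of size at most `m`, where the induced action is
`γ · x = orbitProj Λ X (γ * x)`. -/
def IsAtMostToOne (m : ℕ) (μ : Measure Ω) (X : Set Ω) : Prop :=
  ∀ᵐ x ∂(μ.restrict X), ∀ y : Ω,
    {a : Γ | a⁻¹ • orbitProj Λ X (a • x) = y}.encard ≤ (m : ℕ∞)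

end Couplings

section Groups

variable (Γ : Type u) {Λ : Type v} [Group Γ] [Group Λ]

/-- `Γ` is a `φ`-integrable measure quotient of `Λ = ⟨S⟩`. -/
def IsIntegrableMeasureQuotient (S : Finset Λ) (φ : ℝ → ℝ) : Prop :=
  ∃ (Ω : Type w) (_ : MeasurableSpace Ω) (_ : MulAction Γ Ω) (_ : MulAction Λ Ω)
    (μ : Measure Ω) (X : Set Ω),
    IsQuotientCoupling Γ Λ μ X ∧ IsPhiIntegrable Γ S φ μ X

/-- `Γ` is an at most `m`-to-one `φ`-integrable measure sub-quotient of `Λ = ⟨S⟩`. -/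
def IsAtMostToOneIntegrableMeasureSubQuotient (m : ℕ) (S : Finset Λ) (φ : ℝ → ℝ) : Prop :=
  ∃ (Ω : Type w) (_ : MeasurableSpace Ω) (_ : MulAction Γ Ω) (_ : MulAction Λ Ω)
    (μ : Measure Ω) (X : Set Ω),
    IsSubQuotientCoupling Γ Λ μ X ∧ IsPhiIntegrable Γ S φ μ X ∧ IsAtMostToOne Γ Λ m μ X

end Groups

end MeasureCoupling

end

noncomputable section

namespace MeasureCoupling

/-! ### Sublinear functions -/

section Sublinear

variable {φ : ℝ → ℝ}

/-! A nonnegative f on Λ is transported to Γ through the coupling space. Put F(ω) = ∑ f(b) 1_X(b *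
ω) (`induced`). For y in a fundamental domain Y of Γ, a ↦ F(a * y) is a function on Γ, to which the
isoperimetric inequality of Γ applies; integrating over Y turns sums over Γ into integrals over Ω.
Three estimates are needed.

Gradient: F(a * ω) - F(ω) compares the fundamental domains a⁻¹ * X and X of Λ. On an orbit where
they differ by an element of word length d, f is moved by at most min(2‖f‖₁, d‖∇f‖₁). If s‖∇f‖₁ ≤
‖f‖₁, sublinearity in the form φ(s) min(1, d/s) ≤ φ(d) and φ-integrability give ∫ |F(a * ω) - F(ω)|
= O(‖f‖₁ / φ(s)) (`map_mul_min_le`, `exists_displacement_bound`).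

Support: a ↦ F(a * y) has at most ∑ N(b * y) nonzero values, b ∈ supp f, where N counts the a ∈ Γ
that take a point into X. This need not be bounded, but it is at most K |supp f| on a Γ-invariant
set E that contains at least half of each b⁻¹ * X, b ∈ supp f, with K independent of f
(`exists_le_measure_boundedReturns`).

Mass: consequently ∫_E F ≥ ‖f‖₁ μ(X) / 2.

Together these bound φ(s) by a constant times the profile of Γ at K |supp f|
(`exists_le_isoProfile`). Near-optimal f give the comparison of profiles; indicators of Følner sets,
with the coarea formula on the side of Γ, give that of Følner functions. -/

theorem mul_le_mul_of_monotoneOn_div (hφ_pos : ∀ t : ℝ, 0 < t → 0 < φ t)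
    (hφ_div : MonotoneOn (fun t : ℝ => t / φ t) (Set.Ioi 0)) {s t : ℝ} (hs : 0 < s)
    (hst : s ≤ t) : s * φ t ≤ t * φ s := by
  have h := hφ_div (Set.mem_Ioi.2 hs) (Set.mem_Ioi.2 (hs.trans_le hst)) hst
  simp only at h
  rwa [div_le_div_iff₀ (hφ_pos s hs) (hφ_pos t (hs.trans_le hst))] at h

theorem map_mul_le_mul_map (hφ_pos : ∀ t : ℝ, 0 < t → 0 < φ t)
    (hφ_div : MonotoneOn (fun t : ℝ => t / φ t) (Set.Ioi 0)) {r t : ℝ} (hr : 1 ≤ r)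
    (ht : 0 < t) : φ (r * t) ≤ r * φ t := by
  have h := mul_le_mul_of_monotoneOn_div hφ_pos hφ_div ht (le_mul_of_one_le_left ht.le hr)
  refine le_of_mul_le_mul_left ?_ ht
  linarith

theorem extend_of_pos {t : ℝ} (ht : 0 < t) :
    extend φ (ENNReal.ofReal t) = ENNReal.ofReal (φ t) := by
  unfold extend
  rw [if_neg (by simpa using ht), if_neg ENNReal.ofReal_ne_top, ENNReal.toReal_ofReal ht.le]

/-- A sublinear function at the supremum `J` is controlled by its values below `J`. -/
theorem extend_le_two_mul (hφ_pos : ∀ t : ℝ, 0 < t → 0 < φ t)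
    (hφ_div : MonotoneOn (fun t : ℝ => t / φ t) (Set.Ioi 0)) {J B : ℝ≥0∞}
    (h : ∀ s : ℝ, 0 < s → ENNReal.ofReal s < J → ENNReal.ofReal (φ s) ≤ B) :
    extend φ J ≤ 2 * B := by
  unfold extend
  split_ifs with h0 ht
  · exact zero_le
  · refine iSup₂_le fun s hs => (h s hs (ht ▸ ENNReal.ofReal_lt_top)).trans ?_
    exact le_mul_of_one_le_left zero_le one_le_two
  · have hJ : 0 < J.toReal := ENNReal.toReal_pos h0 ht
    -- Only values strictly below J are controlled; passing from J / 2 to J costs the factor 2.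
    have h1 := h (J.toReal / 2) (half_pos hJ)
      ((ENNReal.ofReal_lt_iff_lt_toReal (half_pos hJ).le ht).2 (half_lt_self hJ))
    have h2 := map_mul_le_mul_map hφ_pos hφ_div one_le_two (half_pos hJ)
    rw [mul_div_cancel₀ _ (two_ne_zero' ℝ)] at h2
    calc ENNReal.ofReal (φ J.toReal) ≤ ENNReal.ofReal (2 * φ (J.toReal / 2)) :=
          ENNReal.ofReal_le_ofReal h2
      _ = 2 * ENNReal.ofReal (φ (J.toReal / 2)) := by
          rw [ENNReal.ofReal_mul zero_le_two, ENNReal.ofReal_ofNat]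
      _ ≤ 2 * B := by gcongr

/-- `min (1, d / s) ≤ (1 + c) φ(d / c) / φ(s)` in a multiplied-out form. -/
theorem map_mul_min_le (hφ_pos : ∀ t : ℝ, 0 < t → 0 < φ t)
    (hφ_mono : MonotoneOn φ (Set.Ioi 0))
    (hφ_div : MonotoneOn (fun t : ℝ => t / φ t) (Set.Ioi 0)) {s : ℝ} (hs : 0 < s) {c : ℝ≥0}
    (hc : 0 < c) (d : ℕ) {D N E : ℝ≥0∞} (hDN : D ≤ 2 * N) (hDE : D ≤ d * E)
    (hEN : ENNReal.ofReal s * E ≤ N) :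
    ENNReal.ofReal (φ s) * D ≤ (1 + c) * extend φ ((d : ℝ≥0∞) / (c : ℝ≥0∞)) * (2 * N) := by
  rcases Nat.eq_zero_or_pos d with rfl | hd
  · have : D = 0 := by simpa using hDE
    simp [this]
  have hd' : (0 : ℝ) < d := by exact_mod_cast hd
  have hc' : (0 : ℝ) < c := by exact_mod_cast hc
  have hdc : (0 : ℝ) < d / c := div_pos hd' hc'
  have hext : extend φ ((d : ℝ≥0∞) / (c : ℝ≥0∞)) = ENNReal.ofReal (φ (d / c)) := by
    rw [← extend_of_pos hdc, ENNReal.ofReal_div_of_pos hc', ENNReal.ofReal_natCast,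
      ENNReal.ofReal_coe_nnreal]
  have hone : (1 + (c : ℝ≥0∞)) = ENNReal.ofReal (1 + c) := by
    rw [ENNReal.ofReal_add zero_le_one hc'.le, ENNReal.ofReal_one, ENNReal.ofReal_coe_nnreal]
  -- The factor 1 + c dominates both 1 and c, so it serves scales below and above 1.
  have hle : (d : ℝ) ≤ (1 + c) * (d / c) := by
    have : (1 + (c : ℝ)) * (d / c) = d / c + d := by field_simp
    linarith
  have hφd : φ d ≤ (1 + c) * φ (d / c) :=
    (hφ_mono hd' (Set.mem_Ioi.2 (hd'.trans_le hle)) hle).trans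
      (map_mul_le_mul_map hφ_pos hφ_div (by linarith) hdc)
  have hC : ENNReal.ofReal (φ d) ≤ (1 + c) * extend φ ((d : ℝ≥0∞) / (c : ℝ≥0∞)) := by
    rw [hext, hone, ← ENNReal.ofReal_mul (by positivity)]
    exact ENNReal.ofReal_le_ofReal hφd
  -- Beyond s the trivial bound D ≤ 2N suffices; below s, monotonicity of t / φ(t) gives d φ(s) ≤ s
  -- φ(d).
  rcases le_total s d with hsd | hds
  · exact mul_le_mul' ((ENNReal.ofReal_le_ofReal (hφ_mono hs hd' hsd)).trans hC) hDN
  · have h1 := mul_le_mul_of_monotoneOn_div hφ_pos hφ_div hd' hds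
    have h2 : (d : ℝ≥0∞) * ENNReal.ofReal (φ s) ≤ ENNReal.ofReal s * ENNReal.ofReal (φ d) := by
      rw [← ENNReal.ofReal_natCast, ← ENNReal.ofReal_mul hd'.le, ← ENNReal.ofReal_mul hs.le]
      exact ENNReal.ofReal_le_ofReal h1
    calc ENNReal.ofReal (φ s) * D ≤ ENNReal.ofReal (φ s) * (d * E) := by gcongr
      _ = (d * ENNReal.ofReal (φ s)) * E := by ring
      _ ≤ (ENNReal.ofReal s * ENNReal.ofReal (φ d)) * E := by gcongr
      _ = ENNReal.ofReal (φ d) * (ENNReal.ofReal s * E) := by ring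
      _ ≤ _ := mul_le_mul' hC (hEN.trans (le_mul_of_one_le_left zero_le one_le_two))

end Sublinear

/-! ### Finitely supported functions -/

section Finsupp

variable {G : Type u}

/-- The pointwise absolute value of a finitely supported function. -/
def absFun (f : G →₀ ℝ) : G →₀ ℝ := f.mapRange (fun r => |r|) abs_zero

@[simp] theorem absFun_apply (f : G →₀ ℝ) (g : G) : absFun f g = |f g| := rfl

theorem l1norm_absFun (f : G →₀ ℝ) : l1norm (absFun f) = l1norm f := by
  simp [l1norm]

theorem support_absFun (f : G →₀ ℝ) : (absFun f).support = f.support := by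
  ext g; simp

theorem l1norm_eq_sum (f : G →₀ ℝ) : l1norm f = ∑ g ∈ f.support, ‖f g‖ₑ :=
  tsum_eq_sum fun g hg => by simpa using hg

theorem l1norm_ne_top (f : G →₀ ℝ) : l1norm f ≠ ∞ := by
  rw [l1norm_eq_sum]
  exact ENNReal.sum_ne_top.2 fun g _ => enorm_ne_top

theorem l1norm_eq_zero {f : G →₀ ℝ} : l1norm f = 0 ↔ f = 0 := by
  simp [l1norm, ENNReal.tsum_eq_zero, Finsupp.ext_iff]

end Finsupp

/-! ### Displacement of finitely supported functions -/

section Displacement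

variable {G : Type u} [Group G]

/-- The `ℓ¹`-distance between `f` and its left translate by `g`. -/
def displacement (g : G) (f : G →₀ ℝ) : ℝ≥0∞ := ∑' h : G, ‖f (g * h) - f h‖ₑ

theorem displacement_le_two_mul (g : G) (f : G →₀ ℝ) :
    displacement g f ≤ 2 * l1norm f := by
  calc displacement g f ≤ ∑' h : G, (‖f (g * h)‖ₑ + ‖f h‖ₑ) :=
        ENNReal.tsum_le_tsum fun h => enorm_sub_le
    _ = 2 * l1norm f := by
        rw [ENNReal.tsum_add, two_mul]
        congr 1
        exact (Equiv.mulLeft g).tsum_eq fun h => ‖f h‖ₑ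

theorem displacement_one (f : G →₀ ℝ) : displacement 1 f = 0 := by simp [displacement]

theorem displacement_mul_le (a b : G) (f : G →₀ ℝ) :
    displacement (a * b) f ≤ displacement a f + displacement b f := by
  have h : displacement a f = ∑' h : G, ‖f (a * (b * h)) - f (b * h)‖ₑ :=
    ((Equiv.mulLeft b).tsum_eq fun h => ‖f (a * h) - f h‖ₑ).symm
  rw [h, displacement, displacement, ← ENNReal.tsum_add]
  refine ENNReal.tsum_le_tsum fun h => ?_
  rw [mul_assoc, ← sub_add_sub_cancel (f (a * (b * h))) (f (b * h)) (f h)]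
  exact enorm_add_le _ _

theorem displacement_inv (a : G) (f : G →₀ ℝ) : displacement a⁻¹ f = displacement a f := by
  rw [displacement, ← (Equiv.mulLeft a).tsum_eq, displacement]
  refine tsum_congr fun h => ?_
  simp only [Equiv.coe_mulLeft, inv_mul_cancel_left]
  rw [← enorm_neg, neg_sub]

theorem displacement_le_l1grad {S : Finset G} {s : G} (hs : s ∈ S ∨ s⁻¹ ∈ S) (f : G →₀ ℝ) :
    displacement s f ≤ l1grad S f := by
  have key : ∀ t ∈ S, displacement t f ≤ l1grad S f := fun t ht =>
    Finset.single_le_sum (f := fun t => displacement t f) (fun _ _ => zero_le) ht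
  rcases hs with hs | hs
  · exact key s hs
  · rw [← displacement_inv]
    exact key _ hs

theorem displacement_prod_le {S : Finset G} (f : G →₀ ℝ) (l : List G)
    (hl : ∀ s ∈ l, s ∈ S ∨ s⁻¹ ∈ S) : displacement l.prod f ≤ l.length * l1grad S f := by
  induction l with
  | nil => simp [displacement_one]
  | cons a l ih =>
    rw [List.prod_cons, List.length_cons, Nat.cast_add, Nat.cast_one, add_mul, one_mul, add_comm]
    exact (displacement_mul_le a l.prod f).trans (add_le_add
      (displacement_le_l1grad (hl a List.mem_cons_self) f)
      (ih fun s hs => hl s (List.mem_cons_of_mem _ hs)))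

theorem exists_list_prod_eq {S : Finset G} (hS : Subgroup.closure (S : Set G) = ⊤) (g : G) :
    ∃ l : List G, (∀ s ∈ l, s ∈ S ∨ s⁻¹ ∈ S) ∧ l.prod = g := by
  have hg : g ∈ (Subgroup.closure (S : Set G)).toSubmonoid := by simp [hS]
  rw [Subgroup.closure_toSubmonoid] at hg
  obtain ⟨l, hl, h⟩ := Submonoid.exists_list_of_mem_closure hg
  exact ⟨l, by simpa using hl, h⟩

theorem countable_of_closure_eq_top {S : Finset G}
    (hS : Subgroup.closure (S : Set G) = ⊤) : Countable G := by
  have : Countable {s : G // s ∈ S ∨ s⁻¹ ∈ S} := by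
    refine Set.Finite.to_subtype (s := {s : G | s ∈ S ∨ s⁻¹ ∈ S}) ?_ |>.to_countable
    exact S.finite_toSet.union (S.finite_toSet.preimage inv_injective.injOn)
  refine Function.Surjective.countable
    (f := fun l : List {s : G // s ∈ S ∨ s⁻¹ ∈ S} => (l.map Subtype.val).prod) fun g => ?_
  obtain ⟨l, hl, rfl⟩ := exists_list_prod_eq hS g
  lift l to List {s : G // s ∈ S ∨ s⁻¹ ∈ S} using hl
  exact ⟨l, rfl⟩

theorem l1grad_absFun_le (S : Finset G) (f : G →₀ ℝ) : l1grad S (absFun f) ≤ l1grad S f := by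
  refine Finset.sum_le_sum fun s _ => ENNReal.tsum_le_tsum fun g => ?_
  rw [enorm_le_iff_norm_le]
  exact abs_abs_sub_abs_le _ _

theorem isoProfile_mono (S : Finset G) : Monotone (isoProfile S) := fun _ _ hxy =>
  iSup₂_le fun f hf => le_iSup₂ (f := fun (f : G →₀ ℝ) (_ : (f.support.card : ℝ) ≤ _) =>
    l1norm f / l1grad S f) f (hf.trans hxy)

/-- Finiteness of the profile excludes the product ∞ * 0 = 0, for which the multiplied form fails.
-/
theorem l1norm_le_isoProfile_mul (S : Finset G) (f : G →₀ ℝ) {x : ℝ}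
    (hf : (f.support.card : ℝ) ≤ x) (hx : isoProfile S x ≠ ∞) :
    l1norm f ≤ isoProfile S x * l1grad S f := by
  have h : l1norm f / l1grad S f ≤ isoProfile S x :=
    le_iSup₂ (f := fun (f : G →₀ ℝ) (_ : (f.support.card : ℝ) ≤ x) =>
      l1norm f / l1grad S f) f hf
  refine (ENNReal.div_le_iff_le_mul (Or.inr hx) (Or.inl ?_)).1 h
  exact ENNReal.sum_ne_top.2 fun s _ => ne_top_of_le_ne_top
    (ENNReal.mul_ne_top ENNReal.ofNat_ne_top (l1norm_ne_top f)) (displacement_le_two_mul s f)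

/-- Passing to |f| keeps norm and support and does not increase the gradient. Positivity is needed
for superlevel sets and to avoid cancellation in `induced`. -/
theorem exists_of_lt_isoProfile {S : Finset G} {k : ℝ≥0∞} {x : ℝ} (h : k < isoProfile S x) :
    ∃ f : G →₀ ℝ, f ≠ 0 ∧ (∀ g, 0 ≤ f g) ∧ (f.support.card : ℝ) ≤ x ∧
      k < l1norm f / l1grad S f := by
  unfold isoProfile at h
  simp only [lt_iSup_iff] at h
  obtain ⟨f, hf, hk⟩ := h
  refine ⟨absFun f, ?_, fun g => abs_nonneg _, by rwa [support_absFun], hk.trans_le ?_⟩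
  · intro h0
    have : l1norm f = 0 := by rw [← l1norm_absFun, h0, l1norm_eq_zero]
    simp [this] at hk
  · rw [l1norm_absFun]
    exact ENNReal.div_le_div_left (l1grad_absFun_le S f) _

end Displacement

/-! ### Sets and functions: the coarea formula -/

section Coarea

open Classical in
/-- The indicator function of a finite set, as a finitely supported function. -/
def indicatorFun {G : Type u} (A : Finset G) : G →₀ ℝ := Finsupp.indicator A fun _ _ => 1

open Classical in
theorem indicatorFun_apply {G : Type u} (A : Finset G) (g : G) :
    indicatorFun A g = if g ∈ A then 1 else 0 := by
  simp [indicatorFun, Finsupp.indicator_apply]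

theorem support_indicatorFun {G : Type u} (A : Finset G) : (indicatorFun A).support = A := by
  ext g; simp [indicatorFun_apply]

theorem l1norm_indicatorFun {G : Type u} (A : Finset G) : l1norm (indicatorFun A) = A.card := by
  rw [l1norm_eq_sum, support_indicatorFun, Finset.sum_congr rfl (g := fun _ => 1)] <;>
    simp +contextual [indicatorFun_apply]

variable {G : Type u} [Group G]

open Classical in
theorem displacement_indicatorFun (s : G) (A : Finset G) :
    displacement s (indicatorFun A) = ((s • A) ∆ A).card := by
  have h : displacement s (indicatorFun A) =
      ∑' g : G, ‖indicatorFun A g - indicatorFun A (s⁻¹ * g)‖ₑ := by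
    rw [displacement, ← (Equiv.mulLeft s).tsum_eq
      fun g => ‖indicatorFun A g - indicatorFun A (s⁻¹ * g)‖ₑ]
    simp
  have h2 : ∀ g : G, ‖indicatorFun A g - indicatorFun A (s⁻¹ * g)‖ₑ =
      if g ∈ (s • A) ∆ A then 1 else 0 := by
    intro g
    have : s⁻¹ * g ∈ A ↔ g ∈ s • A := by rw [← smul_eq_mul, Finset.inv_smul_mem_iff]
    simp only [indicatorFun_apply, Finset.mem_symmDiff, this]
    by_cases h1 : g ∈ A <;> by_cases h2 : g ∈ s • A <;> simp [h1, h2]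
  rw [h, tsum_congr h2, tsum_eq_sum (s := (s • A) ∆ A) (by simp +contextual)]
  rw [Finset.sum_ite_mem, Finset.inter_self]
  simp

/-- A point of A outside SA is outside sA for any chosen s ∈ S. For empty S the boundary is A, while
the gradient vanishes. -/
theorem card_boundary_le_l1grad {S : Finset G} (hS : S.Nonempty) (A : Finset G) :
    ((boundary S A).card : ℝ≥0∞) ≤ l1grad S (indicatorFun A) := by
  classical
  have hsub : boundary S A ⊆ S.biUnion fun s => (s • A) ∆ A := by
    intro g hg
    rw [boundary, Finset.mem_symmDiff] at hg
    rw [Finset.mem_biUnion]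
    rcases hg with ⟨hg, hA⟩ | ⟨hA, hg⟩
    · obtain ⟨s, hs, a, ha, rfl⟩ := Finset.mem_mul.1 hg
      exact ⟨s, hs, Finset.mem_symmDiff.2 (Or.inl ⟨Finset.smul_mem_smul_finset ha, hA⟩)⟩
    · obtain ⟨s, hs⟩ := hS
      refine ⟨s, hs, Finset.mem_symmDiff.2 (Or.inr ⟨hA, fun h => hg ?_⟩)⟩
      obtain ⟨a, ha, rfl⟩ := Finset.mem_smul_finset.1 h
      exact Finset.mul_mem_mul hs ha
  have h := (Finset.card_le_card hsub).trans Finset.card_biUnion_le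
  calc ((boundary S A).card : ℝ≥0∞) ≤ ((∑ s ∈ S, ((s • A) ∆ A).card : ℕ) : ℝ≥0∞) := by
        exact_mod_cast h
    _ = l1grad S (indicatorFun A) := by
        rw [Nat.cast_sum]
        exact Finset.sum_congr rfl fun s _ => (displacement_indicatorFun s A).symm

theorem l1grad_indicatorFun_le (S A : Finset G) :
    l1grad S (indicatorFun A) ≤ (2 * S.card : ℕ) * (boundary S A).card := by
  classical
  have hs : ∀ s ∈ S, displacement s (indicatorFun A) ≤ 2 * (boundary S A).card := by
    intro s hs
    have h1 : (s • A) \ A ⊆ boundary S A := by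
      intro g hg
      obtain ⟨h, hA⟩ := Finset.mem_sdiff.1 hg
      obtain ⟨a, ha, rfl⟩ := Finset.mem_smul_finset.1 h
      exact Finset.mem_symmDiff.2 (Or.inl ⟨Finset.mul_mem_mul hs ha, hA⟩)
    -- The set A \ sA need not lie in the boundary, but it has the size of sA \ A, which does.
    have h2 : (A \ (s • A)).card = ((s • A) \ A).card :=
      Finset.card_sdiff_comm (Finset.card_smul_finset s A).symm
    have h3 : ((s • A) ∆ A).card ≤ 2 * (boundary S A).card := by
      have := Finset.card_le_card h1
      have h4 := Finset.card_union_le ((s • A) \ A) (A \ (s • A))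
      rw [symmDiff_def, Finset.sup_eq_union]
      omega
    rw [displacement_indicatorFun]
    exact_mod_cast h3
  calc l1grad S (indicatorFun A) ≤ ∑ s ∈ S, (2 * (boundary S A).card : ℝ≥0∞) :=
        Finset.sum_le_sum hs
    _ = _ := by
        rw [Finset.sum_const, nsmul_eq_mul]
        push_cast
        ring

open Classical in
-- Layer cake: the two indicators differ exactly for t between a and b, an interval inside [0, ∞).
theorem enorm_sub_eq_lintegral {a b : ℝ} (ha : 0 ≤ a) (hb : 0 ≤ b) :
    ‖a - b‖ₑ = ∫⁻ t in Set.Ici (0 : ℝ),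
      ‖(if t < a then (1 : ℝ) else 0) - (if t < b then 1 else 0)‖ₑ := by
  wlog hab : a ≤ b generalizing a b
  · rw [← enorm_neg, neg_sub, this hb ha (le_of_not_ge hab)]
    refine lintegral_congr fun t => ?_
    rw [← enorm_neg, neg_sub]
  have h : ∀ t : ℝ, ‖(if t < a then (1 : ℝ) else 0) - (if t < b then 1 else 0)‖ₑ =
      (Set.Ico a b).indicator (fun _ => 1) t := by
    intro t
    by_cases h1 : t < a
    · have h2 : t < b := h1.trans_le hab
      simp [h1, h2]
    · by_cases h2 : t < b <;> simp [h1, h2, le_of_not_gt h1]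
  rw [lintegral_congr h, lintegral_indicator_const measurableSet_Ico,
    Measure.restrict_apply measurableSet_Ico, Set.inter_eq_left.2
      (Set.Ico_subset_Ici_self.trans (Set.Ici_subset_Ici.2 ha)), Real.volume_Ico, one_mul,
    ← enorm_neg, neg_sub, Real.enorm_of_nonneg (sub_nonneg.2 hab)]

/-- The superlevel sets of `f`. -/
def superlevel {G : Type u} (f : G →₀ ℝ) (t : ℝ) : Finset G := {g ∈ f.support | t < f g}

open Classical in
theorem indicatorFun_superlevel {G : Type u} (f : G →₀ ℝ) {t : ℝ} (ht : 0 ≤ t) (g : G) :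
    indicatorFun (superlevel f t) g = if t < f g then 1 else 0 := by
  rw [indicatorFun_apply]
  congr 1
  simp only [superlevel, Finset.mem_filter, Finsupp.mem_support_iff, eq_iff_iff,
    and_iff_right_iff_imp]
  intro h
  exact (ht.trans_lt h).ne'

theorem measurable_enorm_ite (a b : ℝ) : Measurable fun t : ℝ =>
    ‖(if t < a then (1 : ℝ) else 0) - (if t < b then 1 else 0)‖ₑ := by
  refine Measurable.enorm (Measurable.sub ?_ ?_) <;>
  exact Measurable.ite measurableSet_Iio measurable_const measurable_const

theorem l1norm_eq_lintegral {G : Type u} [Countable G] {f : G →₀ ℝ} (hf : ∀ g, 0 ≤ f g) :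
    l1norm f = ∫⁻ t in Set.Ici (0 : ℝ), l1norm (indicatorFun (superlevel f t)) := by
  have h : ∀ g, ‖f g‖ₑ = ∫⁻ t in Set.Ici (0 : ℝ),
      ‖(if t < f g then (1 : ℝ) else 0) - (if t < 0 then 1 else 0)‖ₑ := fun g => by
    rw [← enorm_sub_eq_lintegral (hf g) le_rfl, sub_zero]
  rw [l1norm, tsum_congr h, ← lintegral_tsum fun g => (measurable_enorm_ite _ _).aemeasurable]
  refine setLIntegral_congr_fun measurableSet_Ici fun t ht => tsum_congr fun g => ?_
  have ht : 0 ≤ t := ht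
  simp [indicatorFun_superlevel f ht, not_lt.2 ht]

theorem l1grad_eq_lintegral [Countable G] (S : Finset G) {f : G →₀ ℝ} (hf : ∀ g, 0 ≤ f g) :
    l1grad S f = ∫⁻ t in Set.Ici (0 : ℝ), l1grad S (indicatorFun (superlevel f t)) := by
  unfold l1grad
  have hI : ∀ t ∈ Set.Ici (0 : ℝ),
      ∑ s ∈ S, ∑' g, ‖indicatorFun (superlevel f t) (s * g) - indicatorFun (superlevel f t) g‖ₑ =
      ∑ s ∈ S, ∑' g,
        ‖(if t < f (s * g) then (1 : ℝ) else 0) - (if t < f g then 1 else 0)‖ₑ := by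
    intro t ht
    refine Finset.sum_congr rfl fun s _ => tsum_congr fun g => ?_
    rw [indicatorFun_superlevel f ht, indicatorFun_superlevel f ht]
  rw [setLIntegral_congr_fun measurableSet_Ici hI, lintegral_finsetSum]
  · refine Finset.sum_congr rfl fun s _ => ?_
    rw [lintegral_tsum fun g => (measurable_enorm_ite _ _).aemeasurable]
    refine tsum_congr fun g => ?_
    convert enorm_sub_eq_lintegral (hf _) (hf _)
  · exact fun s _ => Measurable.tsum fun g => measurable_enorm_ite _ _

/-- If every nonempty superlevel set A of f had |A| < k |∂A|, integration over the levels would give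
‖f‖₁ ≤ k ‖∇f‖₁. -/
theorem folner_le_of_lt_isoProfile [Countable G] {S : Finset G} (hS : S.Nonempty) {k : ℝ≥0∞}
    (hk : k ≠ ∞) {x : ℝ} (h : k < isoProfile S x) : folner S k ≤ ENNReal.ofReal x := by
  obtain ⟨f, -, hf, hfx, hlt⟩ := exists_of_lt_isoProfile h
  obtain ⟨A, hAf, hA, hAk⟩ : ∃ A ⊆ f.support, A.Nonempty ∧
      ((boundary S A).card : ℝ≥0∞) / (A.card : ℝ≥0∞) ≤ k⁻¹ := by
    by_contra! hcon
    refine hlt.not_ge (ENNReal.div_le_of_le_mul ?_)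
    rw [l1norm_eq_lintegral hf, l1grad_eq_lintegral S hf, ← lintegral_const_mul' _ _ hk]
    refine lintegral_mono fun t => ?_
    rw [l1norm_indicatorFun]
    rcases (superlevel f t).eq_empty_or_nonempty with h0 | h0
    · simp [h0]
    have hc := hcon _ (Finset.filter_subset _ _) h0
    have hne : ((superlevel f t).card : ℝ≥0∞) ≠ 0 := by simpa using h0.ne_empty
    refine le_trans ?_ (mul_le_mul_right (card_boundary_le_l1grad hS _) k)
    have h1 := (ENNReal.lt_div_iff_mul_lt (Or.inl hne) (Or.inl (ENNReal.natCast_ne_top _))).1 hc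
    rcases eq_or_ne k 0 with rfl | hk0
    · simp [hne] at h1
    calc ((superlevel f t).card : ℝ≥0∞) = k * (k⁻¹ * (superlevel f t).card) := by
          rw [← mul_assoc, ENNReal.mul_inv_cancel hk0 hk, one_mul]
      _ ≤ _ := mul_le_mul_right h1.le k
  refine (iInf₂_le_of_le A hA (iInf_le_of_le hAk le_rfl)).trans ?_
  rw [← ENNReal.ofReal_natCast]
  exact ENNReal.ofReal_le_ofReal (le_trans (by exact_mod_cast Finset.card_le_card hAf) hfx)

end Coarea

/-! ### Functions induced on the coupling space -/

section Induced

variable {G : Type v} [Group G] {Ω : Type w} [MulAction G Ω]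

/-- The function `ω ↦ ∑_g f(g) 1_X(g ω)` on a space with an action of `G`. -/
def induced (X : Set Ω) (f : G →₀ ℝ) (ω : Ω) : ℝ :=
  ∑' g : G, X.indicator (fun _ => f g) (g • ω)

theorem induced_eq_sum (X : Set Ω) (f : G →₀ ℝ) (ω : Ω) :
    induced X f ω = ∑ g ∈ f.support, X.indicator (fun _ => f g) (g • ω) :=
  tsum_eq_sum fun g hg => by
    rw [Finsupp.notMem_support_iff.1 hg]
    simp [Set.indicator]

theorem summable_induced (X : Set Ω) (f : G →₀ ℝ) (ω : Ω) :
    Summable fun g : G => X.indicator (fun _ => f g) (g • ω) :=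
  summable_of_ne_finset_zero (s := f.support) fun g hg => by
    rw [Finsupp.notMem_support_iff.1 hg]
    simp [Set.indicator]

/-- If two points of an orbit, one in `X` and the other in `X'`, differ by `k`, then the induced
functions of `X'` and `X` differ on the orbit by the displacement of `f` under `k`. -/
theorem enorm_induced_sub_le {X X' : Set Ω} (f : G →₀ ℝ) {ω x : Ω} {k : G}
    (hX : ∀ g : G, g • ω ∈ X ↔ g • ω = x) (hX' : ∀ g : G, g • ω ∈ X' ↔ g • ω = k • x) :
    ‖induced X' f ω - induced X f ω‖ₑ ≤
      ∑' g : G, X.indicator (fun _ => ‖f (k * g) - f g‖ₑ) (g • ω) := by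
  -- The substitution g ↦ k g matches the two sums term by term, whatever the stabilizers are.
  have hshift : ∀ g : G, X'.indicator (fun _ => f (k * g)) ((k * g) • ω) =
      X.indicator (fun _ => f (k * g)) (g • ω) := by
    intro g
    have : (k * g) • ω ∈ X' ↔ g • ω ∈ X := by
      rw [hX', hX, mul_smul, smul_left_cancel_iff]
    by_cases h : g • ω ∈ X
    · rw [Set.indicator_of_mem h, Set.indicator_of_mem (this.2 h)]
    · rw [Set.indicator_of_notMem h, Set.indicator_of_notMem (mt this.1 h)]
  have h1 : induced X' f ω = ∑' g : G, X.indicator (fun _ => f (k * g)) (g • ω) := by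
    rw [induced, ← (Equiv.mulLeft k).tsum_eq]
    exact tsum_congr hshift
  have hs : Summable fun g : G => X.indicator (fun _ => f (k * g)) (g • ω) := by
    have := (Equiv.mulLeft k).summable_iff.2 (summable_induced X' f ω)
    exact this.congr hshift
  rw [h1, induced, ← hs.tsum_sub (summable_induced X f ω)]
  refine enorm_tsum_le_tsum_enorm.trans (ENNReal.tsum_le_tsum fun g => ?_)
  by_cases h : g • ω ∈ X <;> simp [h]

variable [MeasurableSpace Ω] {μ : Measure Ω}

theorem measurable_induced (hμ : IsMeasurePreservingAction G μ) {X : Set Ω}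
    (hX : MeasurableSet X) (f : G →₀ ℝ) : Measurable (induced X f) := by
  simp only [funext (induced_eq_sum X f)]
  exact Finset.measurable_sum _ fun g _ =>
    (measurable_const.indicator hX).comp (hμ g).measurable

end Induced

/-! ### Displacement between two fundamental domains of one action -/

section FundDomain

variable {G : Type v} [Group G] {Ω : Type w} [MulAction G Ω] [MeasurableSpace Ω] {μ : Measure Ω}

theorem lintegral_indicator_smul (hμ : IsMeasurePreservingAction G μ) {P : Set Ω}
    (hP : MeasurableSet P) (r : ℝ≥0∞) (g : G) :
    ∫⁻ ω, P.indicator (fun _ => r) (g • ω) ∂μ = r * μ P := by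
  rw [(hμ g).lintegral_comp (measurable_const.indicator hP), lintegral_indicator_const hP]

theorem exists_enumeration_words (S : Finset G) (hS : Subgroup.closure (S : Set G) = ⊤) :
    ∃ l : ℕ → List G, ∀ w : List G, (∃ n, l n = w) ↔ ∀ s ∈ w, s ∈ S ∨ s⁻¹ ∈ S := by
  have := countable_of_closure_eq_top hS
  have : Nonempty {w : List G // ∀ s ∈ w, s ∈ S ∨ s⁻¹ ∈ S} := ⟨⟨[], by simp⟩⟩
  obtain ⟨e, he⟩ := exists_surjective_nat {w : List G // ∀ s ∈ w, s ∈ S ∨ s⁻¹ ∈ S}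
  refine ⟨fun n => (e n).1, fun w => ⟨?_, fun hw => ?_⟩⟩
  · rintro ⟨n, rfl⟩
    exact (e n).2
  · obtain ⟨n, hn⟩ := he ⟨w, hw⟩
    exact ⟨n, congrArg Subtype.val hn⟩

/-- X is cut, up to a null set, into countably many pieces, on each of which one fixed word of least
length leads into X'; p n is the measure of the n-th piece. The φ-integral of the distance becomes a
sum over words, and on each piece the difference of the induced functions is the displacement of f
under a fixed element. -/
theorem exists_displacement_bound {S : Finset G} (hS : Subgroup.closure (S : Set G) = ⊤)
    {φ : ℝ → ℝ} (hμ : IsMeasurePreservingAction G μ) {X X' : Set Ω} (hX : IsFundDomain G μ X)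
    (hX' : IsFundDomain G μ X') (hφ : PhiEquivalent S φ μ X X') :
    ∃ c : ℝ≥0, 0 < c ∧ ∃ (l : ℕ → List G) (p : ℕ → ℝ≥0∞),
      (∀ n, ∀ s ∈ l n, s ∈ S ∨ s⁻¹ ∈ S) ∧
      ∑' n, p n * extend φ (((l n).length : ℝ≥0∞) / (c : ℝ≥0∞)) < ∞ ∧
      ∀ f : G →₀ ℝ, ∫⁻ ω, ‖induced X' f ω - induced X f ω‖ₑ ∂μ ≤
        ∑' n, p n * displacement (l n).prod f := by
  have hcount := countable_of_closure_eq_top hS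
  obtain ⟨c, hc, hfin⟩ := hφ
  obtain ⟨hXm, Ω₀, hΩ₀m, hΩ₀, hinv, huniq⟩ := hX
  obtain ⟨hXm', Ω₁, hΩ₁m, hΩ₁, hinv', huniq'⟩ := hX'
  obtain ⟨l, hl⟩ := exists_enumeration_words S hS
  have hl' : ∀ n, ∀ s ∈ l n, s ∈ S ∨ s⁻¹ ∈ S := fun n => (hl (l n)).1 ⟨n, rfl⟩
  have hae : ∀ᵐ ω ∂μ, ω ∈ Ω₀ ∧ ω ∈ Ω₁ := Filter.Eventually.and hΩ₀ hΩ₁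
  -- W n consists of the points of X that the n-th word takes into X', with no shorter word doing
  -- so; `disjointed` then selects the first such word.
  set W : ℕ → Set Ω := fun n => X ∩ ({x | (l n).prod • x ∈ X'} ∩
    ⋂ m, ({x | (l m).prod • x ∈ X'}ᶜ ∪ {_x | (l n).length ≤ (l m).length})) with hW
  have hpre : ∀ n, MeasurableSet {x : Ω | (l n).prod • x ∈ X'} := fun n =>
    (hμ (l n).prod).measurable hXm'
  have hWm : ∀ n, MeasurableSet (W n) := fun n =>
    hXm.inter ((hpre n).inter (MeasurableSet.iInter fun m =>
      (hpre m).compl.union (MeasurableSet.const _)))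
  set P := disjointed W with hP
  have hPm : ∀ n, MeasurableSet (P n) := fun n => MeasurableSet.disjointed hWm n
  have hPW : ∀ n, P n ⊆ W n := disjointed_subset W
  have hPX : ∀ n, P n ⊆ X := fun n => (hPW n).trans Set.inter_subset_left
  refine ⟨c, hc, l, fun n => μ (P n), hl', ?_, fun f => ?_⟩
  · have hdist : ∀ n, ∀ᵐ x ∂μ, x ∈ P n →
        extend φ (((l n).length : ℝ≥0∞) / (c : ℝ≥0∞)) =
          extend φ (schreierDist S x (orbitProj G X' x) / (c : ℝ≥0∞)) := by
      intro n
      filter_upwards [hae] with x hx hxP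
      obtain ⟨-, hxX', hmin⟩ := hPW n hxP
      have hex : ∃ y, y ∈ MulAction.orbit G x ∧ y ∈ X' := ⟨_, ⟨_, rfl⟩, hxX'⟩
      have hproj : orbitProj G X' x = (l n).prod • x := by
        rw [orbitProj, dif_pos hex]
        exact (huniq' x hx.2).unique hex.choose_spec ⟨⟨_, rfl⟩, hxX'⟩
      congr 2
      rw [hproj]
      refine le_antisymm ?_ (iInf₂_le_of_le (l n) (hl' n) (iInf_le_of_le rfl le_rfl))
      refine le_iInf fun w => le_iInf₂ fun hw hwx => ?_
      obtain ⟨m, rfl⟩ := (hl w).2 hw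
      rcases Set.mem_iInter.1 hmin m with h | h
      · exact absurd (show (l m).prod • x ∈ X' from hwx ▸ hxX') h
      · exact_mod_cast h
    calc ∑' n, μ (P n) * extend φ (((l n).length : ℝ≥0∞) / (c : ℝ≥0∞))
        = ∑' n, ∫⁻ x in P n, extend φ (schreierDist S x (orbitProj G X' x) / (c : ℝ≥0∞)) ∂μ := by
          refine tsum_congr fun n => ?_
          rw [← setLIntegral_congr_fun_ae (hPm n) (hdist n), setLIntegral_const, mul_comm]
      _ = ∫⁻ x in ⋃ n, P n, extend φ (schreierDist S x (orbitProj G X' x) / (c : ℝ≥0∞)) ∂μ :=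
          (lintegral_iUnion hPm (disjoint_disjointed W) _).symm
      _ ≤ _ := lintegral_mono_set (Set.iUnion_subset hPX)
      _ < ∞ := hfin
  · calc ∫⁻ ω, ‖induced X' f ω - induced X f ω‖ₑ ∂μ
        ≤ ∫⁻ ω, ∑' n, ∑' g : G,
            (P n).indicator (fun _ => ‖f ((l n).prod * g) - f g‖ₑ) (g • ω) ∂μ := by
          refine lintegral_mono_ae ?_
          filter_upwards [hae] with ω hω
          obtain ⟨x, ⟨⟨a, rfl⟩, hxX⟩, hx⟩ := huniq ω hω.1
          obtain ⟨x', ⟨⟨b, rfl⟩, hxX'⟩, hx'⟩ := huniq' ω hω.2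
          simp only at hxX hxX' hx hx'
          have hexm : ∃ d m, (l m).prod • a • ω ∈ X' ∧ (l m).length = d := by
            obtain ⟨w, hw, hwp⟩ := exists_list_prod_eq hS (b * a⁻¹)
            obtain ⟨m, rfl⟩ := (hl w).2 hw
            refine ⟨_, m, ?_, rfl⟩
            rwa [hwp, smul_smul, inv_mul_cancel_right]
          classical
          obtain ⟨m, hm, hmd⟩ := Nat.find_spec hexm
          have hxW : a • ω ∈ ⋃ n, W n := by
            refine Set.mem_iUnion.2 ⟨m, hxX, hm, Set.mem_iInter.2 fun i => ?_⟩
            by_cases hi : (l i).prod • a • ω ∈ X'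
            · exact Or.inr (hmd.trans_le (Nat.find_min' hexm ⟨i, hi, rfl⟩))
            · exact Or.inl hi
          rw [← iUnion_disjointed] at hxW
          obtain ⟨n, hn⟩ := Set.mem_iUnion.1 hxW
          have hnX' := (hPW n hn).2.1
          have h1 : ∀ g : G, g • ω ∈ X ↔ g • ω = a • ω :=
            fun g => ⟨fun h => hx _ ⟨⟨g, rfl⟩, h⟩, fun h => h ▸ hxX⟩
          have h2 : ∀ g : G, g • ω ∈ X' ↔ g • ω = (l n).prod • a • ω :=
            fun g => ⟨fun h => (hx' _ ⟨⟨g, rfl⟩, h⟩).trans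
              (hx' _ ⟨⟨(l n).prod * a, mul_smul _ _ _⟩, hnX'⟩).symm, fun h => h ▸ hnX'⟩
          refine (enorm_induced_sub_le f h1 h2).trans (le_trans ?_ (ENNReal.le_tsum n))
          refine ENNReal.tsum_le_tsum fun g => ?_
          by_cases h : g • ω ∈ X
          · have hg : g • ω ∈ P n := by rw [(h1 g).1 h]; exact hn
            rw [Set.indicator_of_mem h, Set.indicator_of_mem hg]
          · simp [h]
      _ = ∑' n, μ (P n) * displacement (l n).prod f := by
          have hm : ∀ n (g : G), Measurable fun ω : Ω =>
              (P n).indicator (fun _ => ‖f ((l n).prod * g) - f g‖ₑ) (g • ω) := fun n g =>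
            (measurable_const.indicator (hPm n)).comp (hμ g).measurable
          rw [lintegral_tsum fun n => (Measurable.tsum (hm n)).aemeasurable]
          refine tsum_congr fun n => ?_
          rw [lintegral_tsum fun g => (hm n g).aemeasurable, displacement, ← ENNReal.tsum_mul_left]
          refine tsum_congr fun g => ?_
          rw [lintegral_indicator_smul hμ (hPm n), mul_comm]

end FundDomain

/-! ### Unfolding along a fundamental domain -/

section Unfolding

variable {Γ : Type u} [Group Γ] {Ω : Type w} [MulAction Γ Ω] [MeasurableSpace Ω] {μ : Measure Ω}

theorem IsFundDomain.isFundamentalDomain [Countable Γ] {Y : Set Ω} (hY : IsFundDomain Γ μ Y)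
    (hfree : IsFreeAction Γ μ) : IsFundamentalDomain Γ Y μ := by
  obtain ⟨hYm, Ω₀, -, hΩ₀, -, huniq⟩ := hY
  have hae : ∀ᵐ ω ∂μ, ω ∈ Ω₀ := hΩ₀
  refine ⟨hYm.nullMeasurableSet, ?_, fun a b hab => ?_⟩
  · filter_upwards [hae] with ω hω
    obtain ⟨y, ⟨⟨a, rfl⟩, hy⟩, -⟩ := huniq ω hω
    exact ⟨a, hy⟩
  · have h1 : b * a⁻¹ ≠ 1 := fun h => hab (mul_inv_eq_one.1 h).symm
    have h2 : ∀ᵐ ω ∂μ, ω ∉ a • Y ∩ b • Y := by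
      filter_upwards [hae, hfree _ h1] with ω hω hne hmem
      obtain ⟨⟨y, hy, hay⟩, ⟨z, hz, hbz⟩⟩ := hmem
      simp only at hay hbz
      have hyz : y = z := (huniq ω hω).unique
        ⟨⟨a⁻¹, by simp [← hay]⟩, hy⟩ ⟨⟨b⁻¹, by simp [← hbz]⟩, hz⟩
      apply hne
      rw [mul_smul, ← hay, inv_smul_smul, hyz, hbz, ← hyz, hay]
    exact measure_eq_zero_iff_ae_notMem.2 h2

theorem IsFundDomain.lintegral_eq [Countable Γ] {Y : Set Ω} (hY : IsFundDomain Γ μ Y)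
    (hfree : IsFreeAction Γ μ) (hμ : IsMeasurePreservingAction Γ μ) {F : Ω → ℝ≥0∞}
    (hF : Measurable F) :
    ∫⁻ ω, F ω ∂μ = ∫⁻ y in Y, ∑' a : Γ, F (a • y) ∂μ := by
  have : MeasurableConstSMul Γ Ω := ⟨fun a => (hμ a).measurable⟩
  have : SMulInvariantMeasure Γ Ω μ := ⟨fun a s hs => (hμ a).measure_preimage hs.nullMeasurableSet⟩
  have hm : ∀ a : Γ, Measurable fun ω => F (a • ω) := fun a => hF.comp (hμ a).measurable
  rw [(hY.isFundamentalDomain hfree).lintegral_eq_tsum'',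
    lintegral_tsum fun a => (hm a).aemeasurable]

end Unfolding

/-! ### Return counts -/

section ReturnCount

variable (Γ : Type u) {Λ : Type v} [Group Γ] [Group Λ] {Ω : Type w}
  [MulAction Γ Ω] [MulAction Λ Ω]

/-- The number of elements of `Γ` that take `ω` into `X`. -/
def returnCount (X : Set Ω) (ω : Ω) : ℝ≥0∞ := ∑' a : Γ, X.indicator (fun _ => 1) (a • ω)

variable {Γ}

theorem returnCount_smul (X : Set Ω) (a : Γ) (ω : Ω) :
    returnCount Γ X (a • ω) = returnCount Γ X ω := by
  rw [returnCount, returnCount,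
    ← (Equiv.mulRight a).tsum_eq fun b => X.indicator (fun _ => (1 : ℝ≥0∞)) (b • ω)]
  simp [mul_smul]

/-- The points whose return counts to `X`, averaged over `T`, are at most `K`. -/
def boundedReturns (Γ : Type u) [Group Γ] [MulAction Γ Ω] (X : Set Ω) (K : ℕ) (T : Finset Λ) :
    Set Ω :=
  {ω | ∑ b ∈ T, returnCount Γ X (b • ω) ≤ K * T.card}

/-- Γ-invariance means that restricting to this set keeps or discards whole Γ-orbits, so the
restriction creates no new gradient. -/
theorem smul_mem_boundedReturns (hcomm : ∀ (a : Γ) (b : Λ) (ω : Ω), a • b • ω = b • a • ω)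
    {X : Set Ω} {K : ℕ} {T : Finset Λ} (a : Γ) {ω : Ω} :
    a • ω ∈ boundedReturns Γ X K T ↔ ω ∈ boundedReturns Γ X K T := by
  simp only [boundedReturns, Set.mem_ofPred_eq, ← hcomm, returnCount_smul]

variable [MeasurableSpace Ω] {μ : Measure Ω}

theorem measurable_returnCount [Countable Γ] (hμ : IsMeasurePreservingAction Γ μ) {X : Set Ω}
    (hX : MeasurableSet X) : Measurable (returnCount Γ X) :=
  Measurable.tsum fun a => (measurable_const.indicator hX).comp (hμ a).measurable

theorem measurableSet_boundedReturns [Countable Γ] (hμΓ : IsMeasurePreservingAction Γ μ)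
    (hμΛ : IsMeasurePreservingAction Λ μ) {X : Set Ω} (hX : MeasurableSet X) (K : ℕ)
    (T : Finset Λ) : MeasurableSet (boundedReturns Γ X K T) :=
  measurableSet_le (Finset.measurable_sum _ fun b _ =>
    (measurable_returnCount hμΓ hX).comp (hμΛ b).measurable) measurable_const

variable {X : Set Ω}

/-- Almost all of Ω is covered by countably many translates of X. -/
theorem IsSubQuotientCoupling.measure_ne_zero [Countable Λ]
    (h : IsSubQuotientCoupling Γ Λ μ X) : μ X ≠ 0 := by
  intro h0
  obtain ⟨-, Ω₀, -, hΩ₀, -, huniq⟩ := h.fundDomain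
  have hae : ∀ᵐ ω ∂μ, ω ∈ Ω₀ := hΩ₀
  have h1 : ∀ᵐ ω ∂μ, ∀ b : Λ, b • ω ∉ X := ae_all_iff.2 fun b =>
    (h.preserving_right b).quasiMeasurePreserving.ae (measure_eq_zero_iff_ae_notMem.1 h0)
  have h2 : ∀ᵐ ω ∂μ, False := by
    filter_upwards [hae, h1] with ω hω hn
    obtain ⟨y, ⟨⟨b, rfl⟩, hy⟩, -⟩ := huniq ω hω
    exact hn b hy
  have := h.ne_zero
  rw [Filter.eventually_false_iff_eq_bot, ae_eq_bot] at h2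
  exact this h2

/-- For every finite `T`, at least half of `X` has return counts averaged over `T` at most `K`,
where `K` does not depend on `T`: averages of translates of an integrable function are uniformly
integrable. -/
theorem IsSubQuotientCoupling.exists_le_measure_boundedReturns [Countable Γ] [Countable Λ]
    (h : IsSubQuotientCoupling Γ Λ μ X) :
    ∃ K : ℕ, 0 < K ∧ ∀ T : Finset Λ, T.Nonempty →
      μ X ≤ 2 * μ (X ∩ boundedReturns Γ X K T) := by
  obtain ⟨Y, hY⟩ := h.smooth_left
  have hXm := h.fundDomain.1
  have hμX := h.finite.ne
  have hμX0 := h.measure_ne_zero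
  have hN : ∀ b : Λ, Measurable fun ω => returnCount Γ X (b • ω) := fun b =>
    (measurable_returnCount h.preserving_left hXm).comp (h.preserving_right b).measurable
  -- Unfolding the indicator of b⁻¹ * X along Γ: each translate of the return count has the same
  -- integral over Y.
  have hint : ∀ b : Λ, ∫⁻ y in Y, returnCount Γ X (b • y) ∂μ = μ X := by
    intro b
    have hm : Measurable fun ω => X.indicator (fun _ => (1 : ℝ≥0∞)) (b • ω) :=
      (measurable_const.indicator hXm).comp (h.preserving_right b).measurable
    rw [← one_mul (μ X), ← lintegral_indicator_smul h.preserving_right hXm 1 b,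
      hY.lintegral_eq h.free_left h.preserving_left hm]
    simp only [returnCount, h.commute]
  have hint1 : ∫⁻ y in Y, returnCount Γ X y ∂μ = μ X := by simpa using hint 1
  -- δ comes from absolute continuity of the integral of the return count, and K satisfies K δ >
  -- μ(X). By Markov's inequality the exceptional set E meets Y in measure less than δ, for every T.
  obtain ⟨δ, hδ, hδN⟩ := exists_pos_setLIntegral_lt_of_measure_lt (hint1.trans_ne hμX)
    (ENNReal.half_pos hμX0).ne'
  obtain ⟨K, hK⟩ := ENNReal.exists_nat_mul_gt hδ.ne' hμX
  have hK0 : K ≠ 0 := by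
    rintro rfl
    simp at hK
  refine ⟨K, Nat.pos_of_ne_zero hK0, fun T hT => ?_⟩
  have hEm := measurableSet_boundedReturns h.preserving_left h.preserving_right hXm K T
  obtain ⟨E, hE⟩ : ∃ E, E = (boundedReturns Γ X K T)ᶜ := ⟨_, rfl⟩
  have hEm' : MeasurableSet E := hE ▸ hEm.compl
  have hTne : (T.card : ℝ≥0∞) ≠ 0 := by simpa using hT.ne_empty
  have hsmall : μ.restrict Y E < δ := by
    have hmarkov := mul_meas_ge_le_lintegral (μ := μ.restrict Y)
      (f := fun y => ∑ b ∈ T, returnCount Γ X (b • y))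
      (Finset.measurable_sum _ fun b _ => hN b)
      ((K : ℝ≥0∞) * T.card)
    rw [lintegral_finsetSum _ fun b _ => hN b,
      Finset.sum_congr rfl fun b _ => hint b, Finset.sum_const, nsmul_eq_mul] at hmarkov
    have hsub : μ.restrict Y E ≤ μ.restrict Y
        {y | (K : ℝ≥0∞) * T.card ≤ ∑ b ∈ T, returnCount Γ X (b • y)} :=
      measure_mono fun y hy => by
        rw [hE, Set.mem_compl_iff, boundedReturns, Set.mem_ofPred_eq, not_le] at hy
        exact hy.le
    have h1 : (T.card : ℝ≥0∞) * (K * μ.restrict Y E) < T.card * (K * δ) := by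
      calc (T.card : ℝ≥0∞) * (K * μ.restrict Y E) = K * T.card * μ.restrict Y E := by ring
        _ ≤ _ := mul_le_mul_right hsub _
        _ ≤ T.card * μ X := hmarkov
        _ < _ := ENNReal.mul_lt_mul_right hTne (ENNReal.natCast_ne_top _) hK
    exact lt_of_mul_lt_mul_left' (lt_of_mul_lt_mul_left' h1)
  -- As E is Γ-invariant, μ(X ∩ E) is the integral of the return count over Y ∩ E.
  have hXE : μ (X ∩ E) < μ X / 2 := by
    refine lt_of_eq_of_lt ?_ (hδN E hsmall)
    rw [← one_mul (μ (X ∩ E)), ← lintegral_indicator_const (hXm.inter hEm'),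
      hY.lintegral_eq h.free_left h.preserving_left
        (measurable_const.indicator (hXm.inter hEm')), ← lintegral_indicator hEm']
    refine lintegral_congr fun y => ?_
    have hiff : ∀ a : Γ, a • y ∈ E ↔ y ∈ E := fun a => by
      rw [hE]
      exact not_congr (smul_mem_boundedReturns h.commute a)
    by_cases hy : y ∈ E
    · rw [Set.indicator_of_mem hy]
      refine tsum_congr fun a => ?_
      by_cases ha : a • y ∈ X <;> simp [ha, hy, hiff]
    · rw [Set.indicator_of_notMem hy]
      simp [hy, hiff]
  have hsplit := measure_inter_add_sdiff X hEm (μ := μ)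
  rw [Set.sdiff_eq, ← hE] at hsplit
  have h2 : μ X / 2 + μ X / 2 ≤ μ (X ∩ boundedReturns Γ X K T) + μ X / 2 := by
    rw [ENNReal.add_halves, ← hsplit]
    exact add_le_add_right (hsplit.symm ▸ hXE.le) _
  have h3 := ENNReal.le_of_add_le_add_right (ENNReal.div_ne_top hμX two_ne_zero) h2
  rwa [ENNReal.div_le_iff_le_mul (by simp) (by simp), mul_comm] at h3

end ReturnCount

/-! ### Transfer of almost invariant functions through a coupling -/

section Transfer

variable {Γ : Type u} {Λ : Type v} [Group Γ] [Group Λ] {Ω : Type w} [MulAction Γ Ω]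
  [MulAction Λ Ω]

/-- Without freeness of Λ several terms may be nonzero at one point; positivity of f prevents
cancellation. -/
theorem enorm_induced (X : Set Ω) {f : Λ →₀ ℝ} (hf : ∀ b, 0 ≤ f b) (ω : Ω) :
    ‖induced X f ω‖ₑ = ∑ b ∈ f.support, X.indicator (fun _ => ‖f b‖ₑ) (b • ω) := by
  have h0 : ∀ b ∈ f.support, 0 ≤ X.indicator (fun _ => f b) (b • ω) := fun b _ =>
    Set.indicator_apply_nonneg fun _ => hf b
  rw [induced_eq_sum, Real.enorm_of_nonneg (Finset.sum_nonneg h0),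
    ENNReal.ofReal_sum_of_nonneg h0]
  refine Finset.sum_congr rfl fun b _ => ?_
  by_cases hb : b • ω ∈ X <;> simp [hb, Real.enorm_of_nonneg (hf b)]

theorem induced_image_smul (hcomm : ∀ (a : Γ) (b : Λ) (ω : Ω), a • b • ω = b • a • ω)
    (X : Set Ω) (f : Λ →₀ ℝ) (a : Γ) (ω : Ω) :
    induced ((fun ω => a • ω) '' X) f ω = induced X f (a⁻¹ • ω) := by
  refine tsum_congr fun b => ?_
  have hiff : b • ω ∈ (fun ω => a • ω) '' X ↔ b • a⁻¹ • ω ∈ X := by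
    rw [← hcomm, Set.image_smul, Set.mem_smul_set_iff_inv_smul_mem]
  by_cases h : b • a⁻¹ • ω ∈ X
  · rw [Set.indicator_of_mem h, Set.indicator_of_mem (hiff.2 h)]
  · rw [Set.indicator_of_notMem h, Set.indicator_of_notMem (mt hiff.1 h)]

/-- The set of `a ∈ Γ` with `F(a y) ≠ 0`, for `F` induced by `f`, is controlled by the return
counts of the translates of `y` by the support of `f`. -/
theorem encard_support_induced_le
    (hcomm : ∀ (a : Γ) (b : Λ) (ω : Ω), a • b • ω = b • a • ω) (X : Set Ω) (f : Λ →₀ ℝ) (y : Ω) :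
    ({a : Γ | induced X f (a • y) ≠ 0}.encard : ℝ≥0∞) ≤
      ∑ b ∈ f.support, returnCount Γ X (b • y) := by
  classical
  rw [← ENNReal.tsum_set_one, tsum_subtype {a : Γ | induced X f (a • y) ≠ 0}
    fun _ => (1 : ℝ≥0∞)]
  unfold returnCount
  rw [← Summable.tsum_finsetSum fun _ _ => ENNReal.summable]
  refine ENNReal.tsum_le_tsum fun a => ?_
  by_cases ha' : induced X f (a • y) = 0
  · simp [ha']
  rw [Set.indicator_of_mem (show a ∈ {a : Γ | induced X f (a • y) ≠ 0} from ha')]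
  rw [induced_eq_sum] at ha'
  obtain ⟨b, hb, hne⟩ := Finset.exists_ne_zero_of_sum_ne_zero ha'
  have hmem : a • b • y ∈ X := by
    rw [hcomm]
    exact Set.mem_of_indicator_ne_zero hne
  refine le_trans (le_of_eq ?_) (Finset.single_le_sum
    (f := fun b => X.indicator (fun _ => (1 : ℝ≥0∞)) (a • b • y)) (fun _ _ => zero_le) hb)
  rw [Set.indicator_of_mem hmem]

/-- The isoperimetric inequality of `Γ` along a single `Γ`-orbit. -/
theorem tsum_induced_le_isoProfile_mul
    (hcomm : ∀ (a : Γ) (b : Λ) (ω : Ω), a • b • ω = b • a • ω) (X : Set Ω) (f : Λ →₀ ℝ)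
    (S : Finset Γ) {K : ℕ} (hJ : isoProfile S (K * f.support.card) ≠ ∞) {y : Ω}
    (hy : y ∈ boundedReturns Γ X K f.support) :
    ∑' a : Γ, ‖induced X f (a • y)‖ₑ ≤ isoProfile S (K * f.support.card) *
      ∑ s ∈ S, ∑' a : Γ, ‖induced X f (s • a • y) - induced X f (a • y)‖ₑ := by
  have hcard := (encard_support_induced_le hcomm X f y).trans hy
  have hcard' : {a : Γ | induced X f (a • y) ≠ 0}.encard ≤ ((K * f.support.card : ℕ) : ℕ∞) := by
    have : ((K * f.support.card : ℕ) : ℝ≥0∞) = (((K * f.support.card : ℕ) : ℕ∞) : ℝ≥0∞) := by simp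
    rw [← ENat.toENNReal_le, ← this]
    simpa using hcard
  have hfin : {a : Γ | induced X f (a • y) ≠ 0}.Finite :=
    Set.finite_of_encard_le_coe hcard'
  obtain ⟨F, hF⟩ : ∃ F : Γ →₀ ℝ, ∀ a, F a = induced X f (a • y) :=
    ⟨Finsupp.ofSupportFinite _ hfin, fun _ => rfl⟩
  have hsupp : (F.support : Set Γ) = {a : Γ | induced X f (a • y) ≠ 0} := by
    ext a
    simp [hF]
  rw [← hsupp, Set.encard_coe_eq_coe_finsetCard] at hcard'
  have hFK : F.support.card ≤ K * f.support.card := by exact_mod_cast hcard'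
  have h := l1norm_le_isoProfile_mul S F (x := K * f.support.card) (by exact_mod_cast hFK) hJ
  simpa only [l1norm, l1grad, hF, mul_smul] using h

variable [MeasurableSpace Ω] {μ : Measure Ω} {X : Set Ω}

theorem IsFundDomain.image_smul (hcomm : ∀ (a : Γ) (b : Λ) (ω : Ω), a • b • ω = b • a • ω)
    (hμ : IsMeasurePreservingAction Γ μ) (hX : IsFundDomain Λ μ X) (a : Γ) :
    IsFundDomain Λ μ ((fun ω => a • ω) '' X) := by
  obtain ⟨hXm, Ω₀, hΩ₀m, hΩ₀, hinv, huniq⟩ := hX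
  have himg : (fun ω => a • ω) '' X = (fun ω => a⁻¹ • ω) ⁻¹' X := by
    ext ω
    rw [Set.image_smul, Set.mem_smul_set_iff_inv_smul_mem, Set.mem_preimage]
  refine ⟨himg ▸ (hμ a⁻¹).measurable hXm, (fun ω => a⁻¹ • ω) ⁻¹' Ω₀,
    (hμ a⁻¹).measurable hΩ₀m, ?_, fun b ω hω => ?_, fun ω hω => ?_⟩
  · rw [← Set.preimage_compl, (hμ a⁻¹).measure_preimage hΩ₀m.compl.nullMeasurableSet, hΩ₀]
  · rw [Set.mem_preimage, hcomm]
    exact hinv b _ hω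
  · obtain ⟨x, ⟨⟨b, rfl⟩, hx⟩, hu⟩ := huniq _ hω
    simp only at hx hu
    refine ⟨b • ω, ⟨⟨b, rfl⟩, ?_⟩, ?_⟩
    · rw [himg, Set.mem_preimage, hcomm]
      exact hx
    · rintro _ ⟨⟨b', rfl⟩, hy⟩
      rw [himg, Set.mem_preimage] at hy
      have := hu (a⁻¹ • b' • ω) ⟨⟨b', (hcomm _ _ _).symm⟩, hy⟩
      rw [← hcomm] at this
      exact smul_left_cancel _ this

/-- The gradient of the induced function in the direction `a ∈ Γ`. -/
theorem IsSubQuotientCoupling.exists_lintegral_induced_sub_le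
    (h : IsSubQuotientCoupling Γ Λ μ X) {S : Finset Λ}
    (hS : Subgroup.closure (S : Set Λ) = ⊤) {φ : ℝ → ℝ}
    (hφ_pos : ∀ t : ℝ, 0 < t → 0 < φ t) (hφ_mono : MonotoneOn φ (Set.Ioi 0))
    (hφ_div : MonotoneOn (fun t : ℝ => t / φ t) (Set.Ioi 0))
    (hint : IsPhiIntegrable Γ S φ μ X) (a : Γ) :
    ∃ I : ℝ≥0∞, I ≠ ∞ ∧ ∀ f : Λ →₀ ℝ,
      (∀ s : ℝ, 0 < s → ENNReal.ofReal s * l1grad S f ≤ l1norm f →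
        ENNReal.ofReal (φ s) * ∫⁻ ω, ‖induced X f (a • ω) - induced X f ω‖ₑ ∂μ ≤
          I * l1norm f) ∧
      (l1grad S f = 0 → ∫⁻ ω, ‖induced X f (a • ω) - induced X f ω‖ₑ ∂μ = 0) := by
  -- The inverse appears because ω ↦ F(a * ω) is the function induced from a⁻¹ * X.
  obtain ⟨c, hc, l, p, hl, hfin, hle⟩ := exists_displacement_bound hS h.preserving_right
    h.fundDomain (h.fundDomain.image_smul h.commute h.preserving_left a⁻¹) (hint a⁻¹)
  simp only [induced_image_smul h.commute, inv_inv] at hle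
  refine ⟨2 * (1 + c) * ∑' n, p n * extend φ (((l n).length : ℝ≥0∞) / (c : ℝ≥0∞)),
    ENNReal.mul_ne_top (ENNReal.mul_ne_top ENNReal.ofNat_ne_top (by simp)) hfin.ne,
    fun f => ⟨fun s hs hsf => ?_, fun hf => ?_⟩⟩
  · calc ENNReal.ofReal (φ s) * ∫⁻ ω, ‖induced X f (a • ω) - induced X f ω‖ₑ ∂μ
        ≤ ENNReal.ofReal (φ s) * ∑' n, p n * displacement (l n).prod f :=
          mul_le_mul_right (hle f) _
      _ = ∑' n, p n * (ENNReal.ofReal (φ s) * displacement (l n).prod f) := by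
          rw [← ENNReal.tsum_mul_left]
          exact tsum_congr fun n => by ring
      _ ≤ ∑' n, p n * ((1 + c) * extend φ (((l n).length : ℝ≥0∞) / (c : ℝ≥0∞)) *
            (2 * l1norm f)) :=
          ENNReal.tsum_le_tsum fun n => mul_le_mul_right
            (map_mul_min_le hφ_pos hφ_mono hφ_div hs hc _ (displacement_le_two_mul _ _)
              (displacement_prod_le f (l n) (hl n)) hsf) _
      _ = _ := by
          rw [← ENNReal.tsum_mul_left, ← ENNReal.tsum_mul_right]
          exact tsum_congr fun n => by ring
  · refine le_antisymm ((hle f).trans (le_of_eq ?_)) zero_le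
    refine ENNReal.tsum_eq_zero.2 fun n => ?_
    have := displacement_prod_le f (l n) (hl n)
    rw [hf, mul_zero, nonpos_iff_eq_zero] at this
    rw [this, mul_zero]

/-- The mass of the induced function on the points with bounded return counts. -/
theorem IsSubQuotientCoupling.l1norm_mul_le [Countable Γ]
    (h : IsSubQuotientCoupling Γ Λ μ X) {K : ℕ}
    (hK : ∀ T : Finset Λ, T.Nonempty → μ X ≤ 2 * μ (X ∩ boundedReturns Γ X K T))
    {f : Λ →₀ ℝ} (hf : ∀ b, 0 ≤ f b) :
    l1norm f * μ X ≤
      2 * ∫⁻ ω in boundedReturns Γ X K f.support, ‖induced X f ω‖ₑ ∂μ := by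
  classical
  have hXm := h.fundDomain.1
  have hEm := measurableSet_boundedReturns h.preserving_left h.preserving_right hXm K f.support
  have hpre : ∀ b : Λ, MeasurableSet ((fun ω : Ω => b • ω) ⁻¹' X) := fun b =>
    (h.preserving_right b).measurable hXm
  -- With T = supp f, the element b carries b⁻¹ * X ∩ E(T) onto X ∩ E(T b⁻¹), and K is the same for
  -- all finite sets.
  have hhalf : ∀ b ∈ f.support, μ X ≤
      2 * μ (((fun ω : Ω => b • ω) ⁻¹' X) ∩ boundedReturns Γ X K f.support) := by
    intro b hb
    refine (hK (f.support.image (· * b⁻¹)) (Finset.Nonempty.image ⟨b, hb⟩ _)).trans (le_of_eq ?_)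
    rw [← (h.preserving_right b).measure_preimage (hXm.inter (measurableSet_boundedReturns
      h.preserving_left h.preserving_right hXm K _)).nullMeasurableSet, Set.preimage_inter]
    congr 3
    ext ω
    simp only [boundedReturns, Set.mem_preimage, Set.mem_ofPred_eq]
    rw [Finset.sum_image (mul_left_injective b⁻¹).injOn,
      Finset.card_image_of_injective _ (mul_left_injective b⁻¹)]
    simp only [smul_smul, inv_mul_cancel_right]
  have hm : ∀ b : Λ, Measurable fun ω => X.indicator (fun _ => ‖f b‖ₑ) (b • ω) := fun b =>
    (measurable_const.indicator hXm).comp (h.preserving_right b).measurable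
  simp only [enorm_induced X hf]
  rw [lintegral_finsetSum _ fun b _ => hm b, l1norm_eq_sum, Finset.sum_mul, Finset.mul_sum]
  refine Finset.sum_le_sum fun b hb => ?_
  have hcongr : ∀ ω, X.indicator (fun _ => ‖f b‖ₑ) (b • ω) =
      ((fun ω : Ω => b • ω) ⁻¹' X).indicator (fun _ => ‖f b‖ₑ) ω := fun ω => rfl
  simp only [hcongr]
  rw [lintegral_indicator_const (hpre b), Measure.restrict_apply (hpre b), mul_left_comm]
  exact mul_le_mul_right (hhalf b hb) _

theorem IsSubQuotientCoupling.l1norm_mul_le_isoProfile_mul [Countable Γ]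
    (h : IsSubQuotientCoupling Γ Λ μ X) (S : Finset Γ) {K : ℕ}
    (hK : ∀ T : Finset Λ, T.Nonempty → μ X ≤ 2 * μ (X ∩ boundedReturns Γ X K T))
    {f : Λ →₀ ℝ} (hf : ∀ b, 0 ≤ f b) (hJ : isoProfile S (K * f.support.card) ≠ ∞) :
    l1norm f * μ X ≤ 2 * (isoProfile S (K * f.support.card) *
      ∑ s ∈ S, ∫⁻ ω, ‖induced X f (s • ω) - induced X f ω‖ₑ ∂μ) := by
  obtain ⟨Y, hY⟩ := h.smooth_left
  have hXm := h.fundDomain.1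
  have hEm := measurableSet_boundedReturns h.preserving_left h.preserving_right hXm K f.support
  have hFm := measurable_induced h.preserving_right hXm f
  have hdm : ∀ s : Γ, Measurable fun ω => ‖induced X f (s • ω) - induced X f ω‖ₑ := fun s =>
    ((hFm.comp (h.preserving_left s).measurable).sub hFm).enorm
  have hdm' : ∀ s : Γ, Measurable fun y => ∑' a : Γ,
      ‖induced X f (s • a • y) - induced X f (a • y)‖ₑ := fun s =>
    Measurable.tsum fun a => (hdm s).comp (h.preserving_left a).measurable
  refine (h.l1norm_mul_le hK hf).trans (mul_le_mul_right ?_ 2)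
  rw [← lintegral_indicator hEm, hY.lintegral_eq h.free_left h.preserving_left
    (hFm.enorm.indicator hEm), Finset.sum_congr rfl fun s _ =>
      hY.lintegral_eq h.free_left h.preserving_left (hdm s),
    ← lintegral_finsetSum _ fun s _ => hdm' s, ← lintegral_const_mul' _ _ hJ]
  refine lintegral_mono fun y => ?_
  have hiff : ∀ a : Γ, a • y ∈ boundedReturns Γ X K f.support ↔
      y ∈ boundedReturns Γ X K f.support := fun a => smul_mem_boundedReturns h.commute a
  by_cases hy : y ∈ boundedReturns Γ X K f.support
  · refine le_trans (le_of_eq (tsum_congr fun a => ?_))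
      (tsum_induced_le_isoProfile_mul h.commute X f S hJ hy)
    rw [Set.indicator_of_mem ((hiff a).2 hy)]
  · refine le_trans (le_of_eq (ENNReal.tsum_eq_zero.2 fun a => ?_)) zero_le
    rw [Set.indicator_of_notMem (mt (hiff a).1 hy)]

/-- The mass bound and the gradient bound are combined and ‖f‖₁ is cancelled. The clause on zero
gradient does not follow from the other one if φ is bounded; it serves the case φ⁻¹(k) = ∞. -/
theorem IsSubQuotientCoupling.exists_le_isoProfile [Countable Γ]
    (h : IsSubQuotientCoupling Γ Λ μ X) (SΓ : Finset Γ) {SΛ : Finset Λ}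
    (hS : Subgroup.closure (SΛ : Set Λ) = ⊤) {φ : ℝ → ℝ}
    (hφ_pos : ∀ t : ℝ, 0 < t → 0 < φ t) (hφ_mono : MonotoneOn φ (Set.Ioi 0))
    (hφ_div : MonotoneOn (fun t : ℝ => t / φ t) (Set.Ioi 0))
    (hint : IsPhiIntegrable Γ SΛ φ μ X) :
    ∃ (K : ℕ) (M : ℝ≥0), 0 < K ∧ 0 < M ∧ ∀ f : Λ →₀ ℝ, f ≠ 0 → (∀ b, 0 ≤ f b) →
      (∀ s : ℝ, 0 < s → ENNReal.ofReal s * l1grad SΛ f ≤ l1norm f →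
        ENNReal.ofReal (φ s) ≤ M * isoProfile SΓ (K * f.support.card)) ∧
      (l1grad SΛ f = 0 → isoProfile SΓ (K * f.support.card) = ∞) := by
  have := countable_of_closure_eq_top hS
  obtain ⟨K, hK0, hK⟩ := h.exists_le_measure_boundedReturns
  choose I hI hIf using
    h.exists_lintegral_induced_sub_le hS hφ_pos hφ_mono hφ_div hint
  have hμX0 := h.measure_ne_zero
  have hμX := h.finite.ne
  set M₀ : ℝ≥0∞ := 2 * (∑ s ∈ SΓ, I s) / μ X with hM₀
  have hM₀t : M₀ ≠ ∞ := ENNReal.div_ne_top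
    (ENNReal.mul_ne_top ENNReal.ofNat_ne_top (ENNReal.sum_ne_top.2 fun s _ => hI s)) hμX0
  refine ⟨K, M₀.toNNReal + 1, hK0, by positivity, fun f hf0 hf => ⟨fun s hs hsf => ?_,
    fun hgrad => ?_⟩⟩
  · rcases eq_or_ne (isoProfile SΓ (K * f.support.card)) ∞ with hJ | hJ
    · rw [hJ, ENNReal.mul_top (by simp)]
      exact le_top
    have hmain := h.l1norm_mul_le_isoProfile_mul SΓ hK hf hJ
    set J := isoProfile SΓ (K * f.support.card)
    have hn0 : l1norm f ≠ 0 := mt l1norm_eq_zero.1 hf0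
    have h1 : l1norm f * (ENNReal.ofReal (φ s) * μ X) ≤
        l1norm f * (2 * (∑ s ∈ SΓ, I s) * J) := by
      calc l1norm f * (ENNReal.ofReal (φ s) * μ X)
          = ENNReal.ofReal (φ s) * (l1norm f * μ X) := by ring
        _ ≤ _ := mul_le_mul_right hmain _
        _ = 2 * J * ∑ a ∈ SΓ, ENNReal.ofReal (φ s) *
              ∫⁻ ω, ‖induced X f (a • ω) - induced X f ω‖ₑ ∂μ := by
            rw [← Finset.mul_sum]
            ring
        _ ≤ 2 * J * ∑ a ∈ SΓ, I a * l1norm f :=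
            mul_le_mul_right (Finset.sum_le_sum fun a _ => (hIf a f).1 s hs hsf) _
        _ = _ := by
            rw [← Finset.sum_mul]
            ring
    have h2 := (ENNReal.mul_le_mul_iff_right hn0 (l1norm_ne_top f)).1 h1
    have h3 : ENNReal.ofReal (φ s) ≤ M₀ * J := by
      rw [hM₀, ← ENNReal.mul_div_right_comm]
      exact (ENNReal.le_div_iff_mul_le (Or.inl hμX0) (Or.inl hμX)).2 h2
    refine h3.trans (mul_le_mul_left ?_ J)
    rw [ENNReal.coe_add, ENNReal.coe_toNNReal hM₀t]
    exact le_self_add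
  · by_contra hJ
    have hmain := h.l1norm_mul_le_isoProfile_mul SΓ hK hf hJ
    rw [Finset.sum_eq_zero fun s _ => (hIf s f).2 hgrad, mul_zero, mul_zero, nonpos_iff_eq_zero,
      mul_eq_zero, l1norm_eq_zero] at hmain
    exact hmain.elim hf0 hμX0

end Transfer

/-! ### The generalized inverse -/

section GenInv

variable {φ : ℝ → ℝ} {k : ℝ}

theorem one_le_genInv (hφ_mono : MonotoneOn φ (Set.Ioi 0)) (hk : φ 1 < k) : 1 ≤ genInv φ k := by
  refine le_iInf fun t => le_iInf₂ fun ht hkt => ?_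
  rw [← ENNReal.ofReal_one]
  refine ENNReal.ofReal_le_ofReal (le_of_not_gt fun h => ?_)
  exact absurd (hφ_mono ht (Set.mem_Ioi.2 one_pos) h.le) (not_le.2 (hk.trans_le hkt))

/-- Some τ below twice the infimum satisfies φ(τ) ≥ k; doubling the argument costs a factor 2. -/
theorem le_two_mul_map_genInv (hφ_pos : ∀ t : ℝ, 0 < t → 0 < φ t)
    (hφ_mono : MonotoneOn φ (Set.Ioi 0))
    (hφ_div : MonotoneOn (fun t : ℝ => t / φ t) (Set.Ioi 0)) (h0 : genInv φ k ≠ 0)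
    (ht : genInv φ k ≠ ∞) : k ≤ 2 * φ (genInv φ k).toReal := by
  have hpos := ENNReal.toReal_pos h0 ht
  have hlt : genInv φ k < ENNReal.ofReal (2 * (genInv φ k).toReal) := by
    rw [ENNReal.lt_ofReal_iff_toReal_lt ht]
    linarith
  conv_lhs at hlt => unfold genInv
  simp only [iInf_lt_iff] at hlt
  obtain ⟨τ, hτ, hkτ, hlt⟩ := hlt
  have hle : τ ≤ 2 * (genInv φ k).toReal := ((ENNReal.ofReal_lt_ofReal_iff (by linarith)).1 hlt).le
  exact hkτ.trans ((hφ_mono hτ (Set.mem_Ioi.2 (by linarith)) hle).trans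
    (map_mul_le_mul_map hφ_pos hφ_div one_le_two hpos))

end GenInv

/-! ### Comparison of profiles -/

section Comparison

variable {Γ : Type u} {Λ : Type v} [Group Γ] [Group Λ] {SΓ : Finset Γ} {SΛ : Finset Λ}
  {φ : ℝ → ℝ} {K : ℕ} {M : ℝ≥0}

theorem asympLE_isoProfile (hφ_pos : ∀ t : ℝ, 0 < t → 0 < φ t)
    (hφ_div : MonotoneOn (fun t : ℝ => t / φ t) (Set.Ioi 0)) (hK : 0 < K)
    (h : ∀ f : Λ →₀ ℝ, f ≠ 0 → (∀ b, 0 ≤ f b) → ∀ s : ℝ, 0 < s →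
      ENNReal.ofReal s * l1grad SΛ f ≤ l1norm f →
        ENNReal.ofReal (φ s) ≤ M * isoProfile SΓ (K * f.support.card)) :
    AsympLE (fun x : ℝ => extend φ (isoProfile SΛ x)) (fun x : ℝ => isoProfile SΓ x) := by
  refine ⟨K, by exact_mod_cast hK, 2 * M, Filter.Eventually.of_forall fun x => ?_⟩
  rw [ENNReal.coe_mul, ENNReal.coe_ofNat, mul_assoc]
  refine extend_le_two_mul hφ_pos hφ_div fun s hs hlt => ?_
  obtain ⟨f, hf0, hf, hfx, hsf⟩ := exists_of_lt_isoProfile hlt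
  refine (h f hf0 hf s hs (ENNReal.mul_le_of_le_div hsf.le)).trans
    (mul_le_mul_right (isoProfile_mono SΓ ?_) _)
  exact mul_le_mul_of_nonneg_left hfx (Nat.cast_nonneg K)

theorem asympLE_folner [Countable Γ] (hφ_pos : ∀ t : ℝ, 0 < t → 0 < φ t)
    (hφ_mono : MonotoneOn φ (Set.Ioi 0))
    (hφ_div : MonotoneOn (fun t : ℝ => t / φ t) (Set.Ioi 0)) (hSΓ : SΓ.Nonempty) (hK : 0 < K)
    (hM : 0 < M)
    (h : ∀ f : Λ →₀ ℝ, f ≠ 0 → (∀ b, 0 ≤ f b) →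
      (∀ s : ℝ, 0 < s → ENNReal.ofReal s * l1grad SΛ f ≤ l1norm f →
        ENNReal.ofReal (φ s) ≤ M * isoProfile SΓ (K * f.support.card)) ∧
      (l1grad SΛ f = 0 → isoProfile SΓ (K * f.support.card) = ∞)) :
    AsympLE (fun k : ℝ => folner SΓ (ENNReal.ofReal k))
      (fun k : ℝ => folner SΛ (genInv φ k)) := by
  -- q bounds the ratio of ‖∇1_A‖₁ to |∂A|; the summand 1 keeps it positive if SΛ is empty.
  set q : ℕ := 2 * SΛ.card + 1 with hq
  have hq1 : (1 : ℝ) ≤ q := by simp [hq]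
  have hM' : (0 : ℝ) < M := by exact_mod_cast hM
  have hC : (0 : ℝ) < 4 * q * M := by positivity
  -- Here q pays for replacing t by t / q, one factor 2 for `le_two_mul_map_genInv`, and the other
  -- makes the inequality M k < φ(t / q) strict.
  refine ⟨4 * q * M, hC, K, ?_⟩
  filter_upwards [eventually_gt_atTop 0, eventually_gt_atTop (φ 1 / (4 * q * M))] with k hk hk1
  rw [div_lt_iff₀' hC] at hk1
  have ht1 := one_le_genInv hφ_mono hk1
  have ht2 := le_two_mul_map_genInv (k := 4 * q * M * k) hφ_pos hφ_mono hφ_div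
    (zero_lt_one.trans_le ht1).ne'
  set t := genInv φ (4 * q * M * k)
  have hK' : (K : ℝ≥0∞) ≠ 0 := by exact_mod_cast hK.ne'
  have hKt : (K : ℝ≥0∞) ≠ ∞ := ENNReal.natCast_ne_top K
  suffices hsuff : folner SΓ (ENNReal.ofReal k) / K ≤ folner SΛ t by
    rw [ENNReal.div_le_iff_le_mul (Or.inl hK') (Or.inl hKt), mul_comm] at hsuff
    simpa using hsuff
  refine le_iInf fun A => le_iInf₂ fun hA hAt => ?_
  refine ENNReal.div_le_of_le_mul ?_
  have hA0 : (A.card : ℝ≥0∞) ≠ 0 := by simpa using hA.ne_empty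
  have hf0 : indicatorFun A ≠ 0 := by
    rw [← Finsupp.support_nonempty_iff, support_indicatorFun]
    exact hA
  have hf : ∀ b, 0 ≤ indicatorFun A b := fun b => by
    rw [indicatorFun_apply]
    split_ifs <;> norm_num
  obtain ⟨h1, h2⟩ := h _ hf0 hf
  rw [support_indicatorFun] at h1 h2
  rw [l1norm_indicatorFun] at h1
  have hgrad := l1grad_indicatorFun_le SΛ A
  have hbd := ENNReal.div_le_iff_le_mul (Or.inl hA0) (Or.inl (ENNReal.natCast_ne_top _)) |>.1 hAt
  have hlt : ENNReal.ofReal k < isoProfile SΓ (K * A.card) := by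
    -- For t = ∞ the set A has empty boundary, so its indicator has zero gradient.
    rcases eq_or_ne t ∞ with htop | htop
    · rw [htop, ENNReal.inv_top, zero_mul, nonpos_iff_eq_zero] at hbd
      rw [hbd, mul_zero, nonpos_iff_eq_zero] at hgrad
      rw [h2 hgrad]
      exact ENNReal.ofReal_lt_top
    · have htpos : 0 < t.toReal := ENNReal.toReal_pos (zero_lt_one.trans_le ht1).ne' htop
      -- s = t / q is admissible, since ‖∇1_A‖₁ ≤ q |∂A| ≤ (q / t) |A|.
      have hspos : 0 < t.toReal / q := by positivity
      have hs := h1 (t.toReal / q) hspos ?_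
      · have hφs : φ t.toReal ≤ q * φ (t.toReal / q) := by
          have := map_mul_le_mul_map hφ_pos hφ_div hq1 hspos
          rwa [mul_div_cancel₀ _ (by positivity : (q : ℝ) ≠ 0)] at this
        have hφk : M * k < φ (t.toReal / q) := by
          have h3 : (q : ℝ) * (2 * (M * k)) ≤ q * φ (t.toReal / q) := by
            have := ht2 htop
            linarith
          have h4 := le_of_mul_le_mul_left h3 (by positivity)
          have : 0 < M * k := by positivity
          linarith
        by_contra! hcon
        have h5 := hs.trans (mul_le_mul_right hcon (M : ℝ≥0∞))
        rw [← ENNReal.ofReal_coe_nnreal, ← ENNReal.ofReal_mul hM'.le,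
          ENNReal.ofReal_le_ofReal_iff (by positivity)] at h5
        linarith
      · have htb : t * (boundary SΛ A).card ≤ A.card := by
          calc t * (boundary SΛ A).card ≤ t * (t⁻¹ * A.card) := mul_le_mul_right hbd _
            _ = A.card := by
              rw [← mul_assoc, ENNReal.mul_inv_cancel (zero_lt_one.trans_le ht1).ne' htop, one_mul]
        have hq0 : (q : ℝ≥0∞) ≠ 0 := by simp [hq]
        have hqt : (q : ℝ≥0∞) ≠ ∞ := ENNReal.natCast_ne_top q
        have hst : ENNReal.ofReal (t.toReal / q) = t / q := by
          rw [ENNReal.ofReal_div_of_pos (by positivity), ENNReal.ofReal_toReal htop,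
            ENNReal.ofReal_natCast]
        calc ENNReal.ofReal (t.toReal / q) * l1grad SΛ (indicatorFun A)
            ≤ t / q * (q * (boundary SΛ A).card) := by
              rw [hst]
              refine mul_le_mul_right (hgrad.trans (mul_le_mul_left ?_ _)) _
              exact_mod_cast Nat.le_succ _
          _ = t * (boundary SΛ A).card := by
              rw [← mul_assoc, ENNReal.div_mul_cancel hq0 hqt]
          _ ≤ A.card := htb
  refine (folner_le_of_lt_isoProfile hSΓ ENNReal.ofReal_ne_top hlt).trans (le_of_eq ?_)
  rw [mul_comm, ENNReal.ofReal_mul (Nat.cast_nonneg _), ENNReal.ofReal_natCast,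
    ENNReal.ofReal_natCast]

end Comparison

end MeasureCoupling

end

/-! ### The comparison theorem -/

theorem mainTheorem2 {Γ : Type u} {Λ : Type v} [Group Γ] [Group Λ]
    (SΓ : Finset Γ) (hSΓ : Subgroup.closure (SΓ : Set Γ) = ⊤)
    (SΛ : Finset Λ) (hSΛ : Subgroup.closure (SΛ : Set Λ) = ⊤)
    (φ : ℝ → ℝ) (hφ_pos : ∀ t : ℝ, 0 < t → 0 < φ t)
    (hφ_mono : MonotoneOn φ (Set.Ioi 0))
    (hφ_div : MonotoneOn (fun t : ℝ => t / φ t) (Set.Ioi 0))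
    (h : MeasureCoupling.IsIntegrableMeasureQuotient.{u, v, w} Γ SΛ φ ∨
      ∃ m : ℕ,
        MeasureCoupling.IsAtMostToOneIntegrableMeasureSubQuotient.{u, v, w} Γ m SΛ φ) :
    MeasureCoupling.AsympLE
        (fun x : ℝ => MeasureCoupling.extend φ (MeasureCoupling.isoProfile SΛ x))
        (fun x : ℝ => MeasureCoupling.isoProfile SΓ x) ∧
      (SΓ.Nonempty →
        MeasureCoupling.AsympLE
          (fun k : ℝ => MeasureCoupling.folner SΓ (ENNReal.ofReal k))
          (fun k : ℝ => MeasureCoupling.folner SΛ (MeasureCoupling.genInv φ k))) := by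
  have hcoupling : ∃ (Ω : Type w) (_ : MeasurableSpace Ω) (_ : MulAction Γ Ω) (_ : MulAction Λ Ω)
      (μ : MeasureTheory.Measure Ω) (X : Set Ω),
      MeasureCoupling.IsSubQuotientCoupling Γ Λ μ X ∧
        MeasureCoupling.IsPhiIntegrable Γ SΛ φ μ X := by
    rcases h with ⟨Ω, i₁, i₂, i₃, μ, X, hc, hint⟩ | ⟨m, Ω, i₁, i₂, i₃, μ, X, hc, hint, -⟩
    · exact ⟨Ω, i₁, i₂, i₃, μ, X, hc.toIsSubQuotientCoupling, hint⟩
    · exact ⟨Ω, i₁, i₂, i₃, μ, X, hc, hint⟩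
  obtain ⟨Ω, _, _, _, μ, X, hc, hint⟩ := hcoupling
  have := MeasureCoupling.countable_of_closure_eq_top hSΓ
  obtain ⟨K, M, hK, hM, hKM⟩ :=
    hc.exists_le_isoProfile SΓ hSΛ hφ_pos hφ_mono hφ_div hint
  exact ⟨MeasureCoupling.asympLE_isoProfile hφ_pos hφ_div hK fun f hf0 hf => (hKM f hf0 hf).1,
    fun hne => MeasureCoupling.asympLE_folner hφ_pos hφ_mono hφ_div hne hK hM hKM⟩
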